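/- Let $R$ be a unital commutative ring. An octonion algebra over $R$ is a unital, not necessarily associative $R$-algebra $C$ whose underlying module is finitely generated projective of constant rank $8$, endowed with a quadratic form $q=q_C$ that is multiplicative ($q(xy)=q(x)q(y)$) and regular (its polar form $b_q(x,y)=q(x+y)-q(x)-q(y)$ induces an isomorphism $C\to\mathrm{Hom}_R(C,R)$). Let $C$ be such an algebra, and write $\overline{x}=\kappa(x)=b_q(x,1)1-x$. For a commutative $R$-algebra $S$ put $C_S=C\otimes_R S$; let $q_S$ be the quadratic form on $C_S$ extending $q$, and extend $\kappa$ and the multiplication to $C_S$ linearly. Let $\mathbf{O}(q)(S)$ be the group of invertible $S$-linear isometries of $(C_S,q_S)$, and let $\mathbf{SO}(q)\subseteq\mathbf{O}(q)$ be the special orthogonal group, i.e. the kernel of the Dickson homomorphism: $t\in\mathbf{O}(q)(S)$ lies in $\mathbf{SO}(q)(S)$ if the automorphism of the Clifford algebra of $(C_S,q_S)$ induced by $t$ is the identity on the centre of the even Clifford algebra. Let $\mathrm{Cl}(C,q)$ be the Clifford algebra of $(C,q)$, $\mathrm{Cl}_0(C,q)$ its even part, and $\sigma$ the involution of $\mathrm{Cl}(C,q)$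 (and of its scalar extensions) that fixes $C$ elementwise. Define, for every commutative $R$-algebra $S$, \[\mathbf{Spin}(q_C)(S)=\{u\in(\mathrm{Cl}_0(C,q)\otimes_R S)^* \mid u\cdot C_S\cdot u^{-1}=C_S\ \text{and}\ u\sigma(u)=1\},\] \[\mathbf{RT}'(C)(S)=\{(t_1,t_2,t_3)\in\mathbf{O}(q)(S)^3 \mid t_1(xy)=\overline{t_2(\overline{x})}\;\overline{t_3(\overline{y})}\ \text{for all}\ x,y\in C_S\},\] and let $\mathbf{RT}(C)(S)$ be the subgroup of those triples in $\mathbf{RT}'(C)(S)$ whose three components lie in $\mathbf{SO}(q)(S)$. The linear map $\alpha:C\to\mathrm{End}_R(C\oplus C)$, $\alpha(x)(a,b)=(\overline{x}\,\overline{b},\,\overline{xa})$, satisfies $\alpha(x)^2=q(x)\,\mathrm{Id}$, hence induces an algebra homomorphism $\alpha':\mathrm{Cl}(C,q)\to\mathrm{End}_R(C\oplus C)$. It maps $\mathrm{Cl}_0(C,q)$ to block diagonal operators, and the two diagonal blocks define an algebra homomorphism $\alpha'':\mathrm{Cl}_0(C,q)\to\mathrm{End}_R(C)\times\mathrm{End}_R(C)$.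 Write $\alpha''_S:\mathrm{Cl}_0(C,q)\otimes_R S\to\mathrm{End}_S(C_S)\times\mathrm{End}_S(C_S)$ for its scalar extension. Theorem. The group functors $\mathbf{Spin}(q_C)$ and $\mathbf{RT}'(C)$ are affine group schemes over $R$, the map $\alpha''_S$ is an isomorphism for every commutative $R$-algebra $S$, and there is an isomorphism of affine group schemes \[F:\mathbf{Spin}(q_C)\to\mathbf{RT}'(C),\qquad F_S(u)=(u_1,u_2,u_3),\] where, for every commutative $R$-algebra $S$ and $u\in\mathbf{Spin}(q_C)(S)$, the operator $u_1$ is given by $u_1(x)=u\cdot x\cdot u^{-1}$ for $x\in C_S$, and $u_2,u_3$ are given by $(u_3,u_2)=\alpha''_S(u)$. Moreover, $\mathbf{RT}'(C)(S)=\mathbf{RT}(C)(S)$ for every commutative $R$-algebra $S$. -/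

import Mathlib

open CategoryTheory TensorProduct

universe u

noncomputable section

namespace QuadraticForm

/-! ### Scalar extension of a quadratic form, without inverting `2` -/

section ScalarExtension

variable {R : Type u} [CommRing R] {M : Type u} [AddCommGroup M] [Module R M]

theorem exists_bilin [Module.Projective R M] (q : QuadraticForm R M) :
    ∃ B : LinearMap.BilinForm R M, B.toQuadraticMap = q := by
  obtain ⟨s, hs⟩ := Module.Projective.out (R := R) (P := M)
  let p : (M →₀ R) →ₗ[R] M := Finsupp.linearCombination R id
  obtain ⟨B, hB⟩ := LinearMap.BilinMap.toQuadraticMap_surjective (q.comp p)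
  refine ⟨B.compl₁₂ s s, ?_⟩
  ext x
  have h := congrArg (fun Q => Q (s x)) hB
  simpa [p, hs x] using h

theorem exists_scalarExtension [Module.Projective R M] (q : QuadraticForm R M)
    (S : Type u) [CommRing S] [Algebra R S] :
    ∃ Q : QuadraticForm S (S ⊗[R] M), ∀ x : M, Q (1 ⊗ₜ x) = algebraMap R S (q x) := by
  obtain ⟨B, rfl⟩ := exists_bilin q
  refine ⟨(LinearMap.BilinForm.baseChange S B).toQuadraticMap, fun x => ?_⟩
  simp [Algebra.algebraMap_eq_smul_one]

/-- The quadratic form `q_S` on `M_S = S ⊗ M`: the unique one with `q_S (1 ⊗ x) = q x`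
(uniqueness is `baseChange_ext`). -/
def scalarExtension [Module.Projective R M] (q : QuadraticForm R M)
    (S : Type u) [CommRing S] [Algebra R S] : QuadraticForm S (S ⊗[R] M) :=
  (exists_scalarExtension q S).choose

theorem scalarExtension_one_tmul [Module.Projective R M] (q : QuadraticForm R M)
    (S : Type u) [CommRing S] [Algebra R S] (x : M) :
    q.scalarExtension S (1 ⊗ₜ x) = algebraMap R S (q x) :=
  (exists_scalarExtension q S).choose_spec x

end ScalarExtension

/-! ### The orthogonal and the special orthogonal group of a quadratic form -/

section Orthogonal

variable {S : Type u} [CommRing S] {M : Type u} [AddCommGroup M] [Module S M]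

/-- The orthogonal group `O(Q)`. -/
def orthogonal (Q : QuadraticForm S M) : Subgroup (LinearMap.GeneralLinearGroup S M) where
  carrier := {t | ∀ x, Q (t.1 x) = Q x}
  one_mem' := fun _ => rfl
  mul_mem' := fun {a b} ha hb x => by
    change Q (a.1 (b.1 x)) = Q x
    rw [ha, hb]
  inv_mem' := fun {a} ha x => by
    have h : a.1 (a⁻¹.1 x) = x := LinearMap.congr_fun a.mul_inv x
    change Q (a⁻¹.1 x) = Q x
    rw [← ha, h]

/-- An orthogonal operator as an isometry of quadratic modules. -/
def orthogonal.toIsometry {Q : QuadraticForm S M} (t : Q.orthogonal) : Q →qᵢ Q where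
  toLinearMap := t.1.1
  map_app' := t.2

/-- The special orthogonal group `SO(Q)`, as the kernel of the Dickson homomorphism: the
orthogonal operators `t` whose induced automorphism `Cl(t)` of the Clifford algebra of `Q` is the
identity on the centre of the even Clifford algebra. (For regular forms of even rank.) -/
def specialOrthogonal (Q : QuadraticForm S M) :
    Subgroup (LinearMap.GeneralLinearGroup S M) where
  carrier := {t | ∃ ht : t ∈ Q.orthogonal,
    ∀ z ∈ Subalgebra.center S (CliffordAlgebra.even Q),
      CliffordAlgebra.map (orthogonal.toIsometry ⟨t, ht⟩) z = z}
  one_mem' := ⟨one_mem _, fun z _ => by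
    have : orthogonal.toIsometry (Q := Q) ⟨1, one_mem _⟩ = QuadraticMap.Isometry.id Q := rfl
    rw [this, CliffordAlgebra.map_id]
    rfl⟩
  mul_mem' := by
    rintro a b ⟨ha, ha'⟩ ⟨hb, hb'⟩
    refine ⟨mul_mem ha hb, fun z hz => ?_⟩
    have : orthogonal.toIsometry (Q := Q) ⟨a * b, mul_mem ha hb⟩ =
      (orthogonal.toIsometry ⟨a, ha⟩).comp (orthogonal.toIsometry ⟨b, hb⟩) := rfl
    rw [this, ← CliffordAlgebra.map_comp_map, AlgHom.comp_apply, hb' z hz, ha' z hz]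
  inv_mem' := by
    rintro a ⟨ha, ha'⟩
    refine ⟨inv_mem ha, fun z hz => ?_⟩
    have h : (orthogonal.toIsometry (Q := Q) ⟨a⁻¹, inv_mem ha⟩).comp
        (orthogonal.toIsometry ⟨a, ha⟩) = QuadraticMap.Isometry.id Q := by
      ext x
      exact LinearMap.congr_fun a.inv_mul x
    conv_lhs => rw [← ha' z hz]
    rw [← AlgHom.comp_apply, CliffordAlgebra.map_comp_map, h, CliffordAlgebra.map_id]
    rfl

end Orthogonal

end QuadraticForm

/-! ### Scalar extension of operators along a homomorphism of `R`-rings -/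

namespace ScalarChange

variable {R : Type u} [CommRing R] (M : Type u) [AddCommGroup M] [Module R M]
variable {S T U : Type u} [CommRing S] [Algebra R S] [CommRing T] [Algebra R T]
  [CommRing U] [Algebra R U]

/-- The map `M_S → M_T` induced by `f : S → T`. -/
def map (f : S →ₐ[R] T) : S ⊗[R] M →ₗ[R] T ⊗[R] M := f.toLinearMap.rTensor M

variable {M}

@[simp] theorem map_tmul (f : S →ₐ[R] T) (s : S) (x : M) : map M f (s ⊗ₜ x) = f s ⊗ₜ x := rfl

theorem map_smul (f : S →ₐ[R] T) (s : S) (z : S ⊗[R] M) : map M f (s • z) = f s • map M f z := by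
  induction z with
  | zero => simp
  | tmul a x => simp [smul_tmul']
  | add a b ha hb => simp [ha, hb]

theorem map_mul {C : Type u} [NonAssocRing C] [Module R C] [SMulCommClass R C C]
    [IsScalarTower R C C] (f : S →ₐ[R] T) (a b : S ⊗[R] C) :
    map C f (a * b) = map C f a * map C f b := by
  induction a with
  | zero => simp
  | add a a' ha ha' => simp [add_mul, ha, ha']
  | tmul s x =>
    induction b with
    | zero => simp
    | add b b' hb hb' => simp [mul_add, hb, hb']
    | tmul t y => simp

variable (M)

/-- The operator `t_T` on `M_T` obtained from an operator `t` on `M_S`. -/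
def endMap (f : S →ₐ[R] T) (t : Module.End S (S ⊗[R] M)) : Module.End T (T ⊗[R] M) :=
  LinearMap.liftBaseChange T
    ((map M f ∘ₗ t.restrictScalars R) ∘ₗ (TensorProduct.mk R S M 1))

variable {M}

theorem endMap_one_tmul (f : S →ₐ[R] T) (t : Module.End S (S ⊗[R] M)) (x : M) :
    endMap M f t (1 ⊗ₜ x) = map M f (t (1 ⊗ₜ x)) := by
  simp [endMap]

theorem endMap_map (f : S →ₐ[R] T) (t : Module.End S (S ⊗[R] M)) (z : S ⊗[R] M) :
    endMap M f t (map M f z) = map M f (t z) := by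
  induction z with
  | zero => simp
  | tmul s x =>
    have h1 : s ⊗ₜ[R] x = s • ((1 : S) ⊗ₜ[R] x) := by simp [smul_tmul']
    have h2 : map M f (s ⊗ₜ[R] x) = f s • ((1 : T) ⊗ₜ[R] x) := by simp [smul_tmul']
    rw [h2, _root_.map_smul, endMap_one_tmul, ← map_smul, ← _root_.map_smul, ← h1]
  | add a b ha hb => simp [ha, hb]

theorem end_ext {s t : Module.End T (T ⊗[R] M)}
    (h : ∀ x : M, s (1 ⊗ₜ x) = t (1 ⊗ₜ x)) : s = t := by
  ext x
  simpa using h x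

variable (M)

/-- The homomorphism `GL(M)(S) → GL(M)(T)`. -/
def glMap (f : S →ₐ[R] T) : LinearMap.GeneralLinearGroup S (S ⊗[R] M) →*
    LinearMap.GeneralLinearGroup T (T ⊗[R] M) :=
  Units.map
    { toFun := endMap M f
      map_one' := end_ext fun x => by rw [endMap_one_tmul]; simp
      map_mul' := fun s t => end_ext fun x => by
        rw [endMap_one_tmul, Module.End.mul_apply, Module.End.mul_apply, endMap_one_tmul,
          endMap_map] }

variable {M}

theorem glMap_map (f : S →ₐ[R] T) (t : LinearMap.GeneralLinearGroup S (S ⊗[R] M))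
    (z : S ⊗[R] M) : (glMap M f t).1 (map M f z) = map M f (t.1 z) :=
  endMap_map f t.1 z

theorem glMap_one_tmul (f : S →ₐ[R] T) (t : LinearMap.GeneralLinearGroup S (S ⊗[R] M))
    (x : M) : (glMap M f t).1 (1 ⊗ₜ x) = map M f (t.1 (1 ⊗ₜ x)) :=
  endMap_one_tmul f t.1 x

theorem glMap_id (t : LinearMap.GeneralLinearGroup S (S ⊗[R] M)) :
    glMap M (AlgHom.id R S) t = t :=
  Units.ext <| end_ext fun x => by
    rw [glMap_one_tmul]
    exact LinearMap.rTensor_id_apply _ _ _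

theorem map_comp (f : S →ₐ[R] T) (g : T →ₐ[R] U) (z : S ⊗[R] M) :
    map M (g.comp f) z = map M g (map M f z) := by
  induction z with
  | zero => simp
  | tmul s x => simp
  | add a b ha hb => simp [ha, hb]

theorem glMap_comp (f : S →ₐ[R] T) (g : T →ₐ[R] U)
    (t : LinearMap.GeneralLinearGroup S (S ⊗[R] M)) :
    glMap M (g.comp f) t = glMap M g (glMap M f t) :=
  Units.ext <| end_ext fun x => by
    rw [glMap_one_tmul, glMap_one_tmul, glMap_one_tmul, map_comp]

theorem scalarExtension_map [Module.Projective R M] (q : QuadraticForm R M) (f : S →ₐ[R] T)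
    (z : S ⊗[R] M) : q.scalarExtension T (map M f z) = f (q.scalarExtension S z) := by
  let _ : Algebra S T := f.toRingHom.toAlgebra
  have _ : IsScalarTower R S T := IsScalarTower.of_algebraMap_eq fun r => (f.commutes r).symm
  have hs : ∀ (s : S) (z : S ⊗[R] M), map M f (s • z) = s • map M f z := map_smul f
  let m : S ⊗[R] M →ₗ[S] T ⊗[R] M := { map M f with map_smul' := hs }
  have h : ((q.scalarExtension T).restrictScalars (S := S)).comp m =
      (Algebra.linearMap S T).compQuadraticMap (q.scalarExtension S) := by
    apply baseChange_ext
    intro x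
    change q.scalarExtension T (map M f (1 ⊗ₜ x)) = f (q.scalarExtension S (1 ⊗ₜ x))
    rw [map_tmul, map_one, q.scalarExtension_one_tmul, q.scalarExtension_one_tmul, f.commutes]
  exact congrArg (fun Q => Q z) h

theorem glMap_mem_orthogonal [Module.Projective R M] (q : QuadraticForm R M) (f : S →ₐ[R] T)
    {t : LinearMap.GeneralLinearGroup S (S ⊗[R] M)} (ht : t ∈ (q.scalarExtension S).orthogonal) :
    glMap M f t ∈ (q.scalarExtension T).orthogonal := by
  have h : (q.scalarExtension T).comp (glMap M f t).1 = q.scalarExtension T := by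
    apply baseChange_ext
    intro x
    rw [QuadraticMap.comp_apply, glMap_one_tmul, scalarExtension_map, ht, ← scalarExtension_map,
      map_tmul, map_one]
  exact fun x => congrArg (fun Q => Q x) h

end ScalarChange

/-! ### Octonion algebras -/

/-- An octonion algebra over `R`: a unital, not necessarily associative `R`-algebra `C` whose
underlying module is finitely generated projective of constant rank `8`, with a regular
multiplicative quadratic form. -/
class OctonionAlgebra (R C : Type u) [CommRing R] [NonAssocRing C] [Module R C]
    [SMulCommClass R C C] [IsScalarTower R C C] where
  norm : QuadraticForm R C
  finite : Module.Finite R C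
  projective : Module.Projective R C
  rank_eq_eight : ∀ p : PrimeSpectrum R, Module.rankAtStalk C p = 8
  norm_mul : ∀ x y : C, norm (x * y) = norm x * norm y
  regular : Function.Bijective (norm.polarBilin : C → Module.Dual R C)

namespace OctonionAlgebra

variable (R C : Type u) [CommRing R] [NonAssocRing C] [Module R C]
  [SMulCommClass R C C] [IsScalarTower R C C] [OctonionAlgebra R C]

instance : Module.Finite R C := OctonionAlgebra.finite
instance : Module.Projective R C := OctonionAlgebra.projective

/-- The standard involution `κ : x ↦ x̄ = b(x, 1) 1 - x`. -/
def conj : C →ₗ[R] C :=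
  ((norm (R := R) (C := C)).polarBilin 1).smulRight (1 : C) - LinearMap.id

variable {R C}

local notation "nq" => norm (R := R) (C := C)
local notation "bq" => QuadraticMap.polarBilin (norm (R := R) (C := C))

theorem conj_apply (x : C) : conj R C x = bq 1 x • (1 : C) - x := rfl

theorem polar_comm (x y : C) : bq x y = bq y x := QuadraticMap.polar_comm _ _ _

theorem eq_of_polar {x y : C} (h : ∀ z, bq x z = bq y z) : x = y :=
  (regular (R := R) (C := C)).1 (LinearMap.ext h)

theorem polar_mul_left (x y z : C) : bq (x * y) (x * z) = nq x * bq y z := by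
  simp only [QuadraticMap.polarBilin_apply_apply, QuadraticMap.polar, ← mul_add, norm_mul]
  ring

theorem polar_mul_right (x z y : C) : bq (x * y) (z * y) = bq x z * nq y := by
  simp only [QuadraticMap.polarBilin_apply_apply, QuadraticMap.polar, ← add_mul, norm_mul]
  ring

theorem polar_mul_add (x z y w : C) :
    bq (x * y) (z * w) + bq (x * w) (z * y) = bq x z * bq y w := by
  have h := polar_mul_right (R := R) x z (y + w)
  have h1 := polar_mul_right (R := R) x z y
  have h2 := polar_mul_right (R := R) x z w
  have h3 : nq (y + w) = nq y + nq w + bq y w := by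
    simp [QuadraticMap.polar]
  rw [mul_add, mul_add, map_add, map_add, LinearMap.add_apply, LinearMap.add_apply, h3] at h
  linear_combination h - h1 - h2

theorem norm_one_mul (x y : C) : nq 1 * bq x y = bq x y := by
  simpa using (polar_mul_left (R := R) 1 x y).symm

theorem polar_conj_mul (x y w : C) : bq (conj R C x * y) w = bq y (x * w) := by
  have h := polar_mul_add (R := R) x 1 y w
  rw [conj_apply, sub_mul, smul_mul_assoc, one_mul, map_sub, _root_.map_smul,
    LinearMap.sub_apply, LinearMap.smul_apply, smul_eq_mul, polar_comm y (x * w),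
    polar_comm 1 x]
  rw [one_mul, one_mul] at h
  linear_combination -h

theorem conj_mul_mul (x y : C) : conj R C x * (x * y) = nq x • y := by
  apply eq_of_polar (R := R)
  intro z
  rw [polar_conj_mul, polar_mul_left, _root_.map_smul, LinearMap.smul_apply, smul_eq_mul]

theorem norm_conj (x : C) : nq (conj R C x) = nq x := by
  have h := norm_one_mul (R := R) 1 x
  rw [conj_apply, sub_eq_add_neg, QuadraticMap.map_add nq, QuadraticMap.map_smul,
    QuadraticMap.map_neg]
  have h2 : QuadraticMap.polar nq (bq 1 x • (1 : C)) (-x) = - (bq 1 x * bq 1 x) := by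
    simp
  rw [h2, smul_eq_mul]
  linear_combination (bq 1 x) * h

theorem conj_conj (x : C) : conj R C (conj R C x) = x := by
  have h := norm_one_mul (R := R) 1 x
  have h1 : bq 1 (1 : C) = 2 * nq 1 := by
    simp [two_mul]
  rw [conj_apply, conj_apply, map_sub, _root_.map_smul, smul_eq_mul, h1]
  have h3 : bq 1 x * (2 * nq 1) - bq 1 x = bq 1 x := by linear_combination 2 * h
  rw [h3]
  abel

theorem mul_conj_mul (x y : C) : x * (conj R C x * y) = nq x • y := by
  have h := conj_mul_mul (R := R) (conj R C x) y
  rwa [conj_conj, norm_conj] at h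

variable (R C)

/-- `α(x) = (0, L_{x̄} κ; κ L_x, 0)` on `C ⊕ C`, that is
`α(x)(a, b) = (x̄ b̄, \overline{x a})`. -/
def alpha : C →ₗ[R] Module.End R (C × C) :=
  LinearMap.mk₂ R
    (fun x p => (conj R C x * conj R C p.2, conj R C (x * p.1)))
    (fun x y p => by simp [add_mul])
    (fun r x p => by simp [smul_mul_assoc])
    (fun x p p' => by simp [mul_add])
    (fun r x p => by simp [mul_smul_comm])

variable {R C} in
theorem alpha_apply (x : C) (p : C × C) :
    alpha R C x p = (conj R C x * conj R C p.2, conj R C (x * p.1)) := rfl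

/-- The homomorphism `α' : Cl(C, q) → End(C ⊕ C)` induced by `α`. -/
def alphaCl : CliffordAlgebra nq →ₐ[R] Module.End R (C × C) :=
  CliffordAlgebra.lift nq ⟨alpha R C, fun x => by
    refine LinearMap.ext fun p => ?_
    rw [Module.End.mul_apply, alpha_apply, alpha_apply, conj_conj, conj_mul_mul, mul_conj_mul,
      _root_.map_smul, conj_conj]
    rfl⟩

variable {R C} in
theorem alphaCl_even {u : CliffordAlgebra nq} (hu : u ∈ CliffordAlgebra.even nq) :
    (∀ a : C, alphaCl R C u (a, 0) = ((alphaCl R C u (a, 0)).1, 0)) ∧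
      ∀ b : C, alphaCl R C u (0, b) = (0, (alphaCl R C u (0, b)).2) := by
  have hα : ∀ x : C, alphaCl R C (CliffordAlgebra.ι nq x) = alpha R C x := fun x =>
    CliffordAlgebra.lift_ι_apply _ _ _
  suffices h : (∀ a : C, (alphaCl R C u (a, 0)).2 = 0) ∧
      ∀ b : C, (alphaCl R C u (0, b)).1 = 0 from
    ⟨fun a => Prod.ext rfl (h.1 a), fun b => Prod.ext (h.2 b) rfl⟩
  induction u, hu using CliffordAlgebra.even_induction nq with
  | algebraMap r => simp [AlgHom.commutes, Module.algebraMap_end_apply]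
  | add x y hx hy ihx ihy => exact ⟨fun a => by simp [ihx.1 a, ihy.1 a],
      fun b => by simp [ihx.2 b, ihy.2 b]⟩
  | ι_mul_ι_mul m₁ m₂ x hx ih =>
    refine ⟨fun a => ?_, fun b => ?_⟩
    · simp [map_mul, hα, alpha_apply, Module.End.mul_apply, ih.1 a]
    · simp [map_mul, hα, alpha_apply, Module.End.mul_apply, ih.2 b]

/-- The homomorphism `α'' : Cl₀(C, q) → End(C) × End(C)`: the diagonal blocks `(u₃, u₂)` of
`α'(u) = (u₃, 0; 0, u₂)`. -/
def alphaEven : CliffordAlgebra.even nq →ₐ[R] Module.End R C × Module.End R C :=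
  AlgHom.ofLinearMap
    { toFun := fun u =>
        (LinearMap.fst R C C ∘ₗ alphaCl R C u ∘ₗ LinearMap.inl R C C,
          LinearMap.snd R C C ∘ₗ alphaCl R C u ∘ₗ LinearMap.inr R C C)
      map_add' := fun u v => by
        refine Prod.ext (LinearMap.ext fun a => ?_) (LinearMap.ext fun a => ?_) <;> simp
      map_smul' := fun r u => by
        refine Prod.ext (LinearMap.ext fun a => ?_) (LinearMap.ext fun a => ?_) <;> simp }
    (by refine Prod.ext (LinearMap.ext fun a => ?_) (LinearMap.ext fun a => ?_) <;> simp)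
    (fun u v => by
      refine Prod.ext (LinearMap.ext fun a => ?_) (LinearMap.ext fun b => ?_)
      · change (alphaCl R C (u * v) (a, 0)).1 =
          (alphaCl R C u ((alphaCl R C v (a, 0)).1, 0)).1
        rw [map_mul, Module.End.mul_apply, ← (alphaCl_even v.2).1 a]
      · change (alphaCl R C (u * v) (0, b)).2 =
          (alphaCl R C u (0, (alphaCl R C v (0, b)).2)).2
        rw [map_mul, Module.End.mul_apply, ← (alphaCl_even v.2).2 b])

variable {R C} in
theorem alphaCl_eq_diagonal (u : CliffordAlgebra.even nq) (a b : C) :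
    alphaCl R C u (a, b) = ((alphaEven R C u).1 a, (alphaEven R C u).2 b) := by
  have h : ((a, b) : C × C) = (a, 0) + (0, b) := by simp
  rw [h, map_add, (alphaCl_even u.2).1 a, (alphaCl_even u.2).2 b]
  change (_ + 0, 0 + _) = _
  rw [add_zero, zero_add]
  rfl

/-! ### Scalar extension of the structure of `C` -/

section Points

variable {R C} (S : Type u) [CommRing S] [Algebra R S]

/-- The norm `q_S` of `C_S = S ⊗ C`. -/
abbrev normS : QuadraticForm S (S ⊗[R] C) := QuadraticForm.scalarExtension nq S

/-- The involution `κ_S` of `C_S`. -/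
def conjS : S ⊗[R] C →ₗ[S] S ⊗[R] C := (conj R C).baseChange S

/-- The inclusion of `C_S` into `Cl(C, q)_S`. -/
def iotaS : S ⊗[R] C →ₗ[S] S ⊗[R] CliffordAlgebra nq := (CliffordAlgebra.ι nq).baseChange S

/-- The inclusion of `Cl₀(C, q)_S` into `Cl(C, q)_S`. -/
def evenS : S ⊗[R] CliffordAlgebra.even nq →ₐ[S] S ⊗[R] CliffordAlgebra nq :=
  Algebra.TensorProduct.map (AlgHom.id S S) (CliffordAlgebra.even nq).val

/-- The main involution `σ` of `Cl(C, q)_S`, which fixes `C_S`. -/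
def sigmaS : S ⊗[R] CliffordAlgebra nq →ₗ[S] S ⊗[R] CliffordAlgebra nq :=
  (CliffordAlgebra.reverse (Q := nq)).baseChange S

/-- The homomorphism `α''_S : Cl₀(C, q)_S → End_S(C_S) × End_S(C_S)`. -/
def alphaEvenS : S ⊗[R] CliffordAlgebra.even nq →ₐ[S]
    Module.End S (S ⊗[R] C) × Module.End S (S ⊗[R] C) :=
  AlgHom.prod
    (Algebra.TensorProduct.lift (Algebra.ofId S _)
      ((Module.End.baseChangeHom R S C).comp
        ((AlgHom.fst R (Module.End R C) (Module.End R C)).comp (alphaEven R C)))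
      (fun s _ => Algebra.commutes s _))
    (Algebra.TensorProduct.lift (Algebra.ofId S _)
      ((Module.End.baseChangeHom R S C).comp
        ((AlgHom.snd R (Module.End R C) (Module.End R C)).comp (alphaEven R C)))
      (fun s _ => Algebra.commutes s _))

variable {S}

theorem conjS_conjS (z : S ⊗[R] C) : conjS (R := R) S (conjS (R := R) S z) = z := by
  induction z with
  | zero => simp
  | tmul s x => simp [conjS, conj_conj]
  | add a b ha hb => simp [ha, hb]

theorem sigmaS_mul (a b : S ⊗[R] CliffordAlgebra nq) :
    sigmaS S (a * b) = sigmaS S b * sigmaS S a := by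
  induction a with
  | zero => simp
  | add a a' ha ha' => simp [add_mul, mul_add, ha, ha']
  | tmul s x =>
    induction b with
    | zero => simp
    | add b b' hb hb' => simp [add_mul, mul_add, hb, hb']
    | tmul t y => simp [sigmaS, mul_comm]

theorem sigmaS_one : sigmaS S (1 : S ⊗[R] CliffordAlgebra nq) = 1 := by
  simp [sigmaS, Algebra.TensorProduct.one_def]

variable {T : Type u} [CommRing T] [Algebra R T]

theorem conjS_map (f : S →ₐ[R] T) (z : S ⊗[R] C) :
    conjS (R := R) T (ScalarChange.map C f z) = ScalarChange.map C f (conjS (R := R) S z) := by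
  induction z with
  | zero => simp
  | tmul s x => simp [conjS]
  | add a b ha hb => simp [ha, hb]

/-- The homomorphism `Cl(C, q)_S → Cl(C, q)_T` induced by `f : S → T`. -/
def clMap (f : S →ₐ[R] T) : S ⊗[R] CliffordAlgebra nq →ₐ[R] T ⊗[R] CliffordAlgebra nq :=
  Algebra.TensorProduct.map f (AlgHom.id R _)

/-- The homomorphism `Cl₀(C, q)_S → Cl₀(C, q)_T` induced by `f : S → T`. -/
def evenMap (f : S →ₐ[R] T) :
    S ⊗[R] CliffordAlgebra.even nq →ₐ[R] T ⊗[R] CliffordAlgebra.even nq :=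
  Algebra.TensorProduct.map f (AlgHom.id R _)

theorem evenS_evenMap (f : S →ₐ[R] T) (u : S ⊗[R] CliffordAlgebra.even nq) :
    evenS T (evenMap f u) = clMap f (evenS S u) := by
  induction u with
  | zero => simp
  | tmul s x => simp [evenS, evenMap, clMap]
  | add a b ha hb => simp [ha, hb]

theorem iotaS_map (f : S →ₐ[R] T) (z : S ⊗[R] C) :
    iotaS T (ScalarChange.map C f z) = clMap f (iotaS S z) := by
  induction z with
  | zero => simp
  | tmul s x => simp [iotaS, clMap]
  | add a b ha hb => simp [ha, hb]

theorem sigmaS_clMap (f : S →ₐ[R] T) (z : S ⊗[R] CliffordAlgebra nq) :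
    sigmaS T (clMap f z) = clMap f (sigmaS S z) := by
  induction z with
  | zero => simp
  | tmul s x => simp [sigmaS, clMap]
  | add a b ha hb => simp [ha, hb]

end Points

/-! ### The group schemes `Spin(q_C)`, `RT'(C)` and `RT(C)`, as functors of points -/

section Groups

variable (S : Type u) [CommRing S] [Algebra R S]

/-- `C_S`, as a subset of `Cl(C, q)_S`. -/
def vectors : Set (S ⊗[R] CliffordAlgebra nq) := Set.range (iotaS (R := R) (C := C) S)

variable {R C S} in
theorem conj_image_eq_iff (u : (S ⊗[R] CliffordAlgebra.even nq)ˣ) :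
    (fun c => evenS S (u : S ⊗[R] CliffordAlgebra.even nq) * c *
        evenS S (↑u⁻¹ : S ⊗[R] CliffordAlgebra.even nq)) '' vectors R C S = vectors R C S ↔
      (∀ c ∈ vectors R C S, evenS S u.1 * c * evenS S u⁻¹.1 ∈ vectors R C S) ∧
      ∀ c ∈ vectors R C S, evenS S u⁻¹.1 * c * evenS S u.1 ∈ vectors R C S := by
  have h1 : evenS S u.1 * evenS S u⁻¹.1 = 1 := by rw [← map_mul, u.mul_inv, map_one]
  have h2 : evenS S u⁻¹.1 * evenS S u.1 = 1 := by rw [← map_mul, u.inv_mul, map_one]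
  have h3 : ∀ c, evenS S u⁻¹.1 * (evenS S u.1 * c * evenS S u⁻¹.1) * evenS S u.1 = c := fun c =>
    calc _ = (evenS S u⁻¹.1 * evenS S u.1) * c * (evenS S u⁻¹.1 * evenS S u.1) := by noncomm_ring
      _ = c := by rw [h2, one_mul, mul_one]
  have h4 : ∀ c, evenS S u.1 * (evenS S u⁻¹.1 * c * evenS S u.1) * evenS S u⁻¹.1 = c := fun c =>
    calc _ = (evenS S u.1 * evenS S u⁻¹.1) * c * (evenS S u.1 * evenS S u⁻¹.1) := by noncomm_ring
      _ = c := by rw [h1, one_mul, mul_one]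
  constructor
  · intro h
    refine ⟨fun c hc => h ▸ ⟨c, hc, rfl⟩, fun c hc => ?_⟩
    rw [← h] at hc
    obtain ⟨d, hd, rfl⟩ := hc
    change evenS S u⁻¹.1 * (evenS S u.1 * d * evenS S u⁻¹.1) * evenS S u.1 ∈ _
    rwa [h3]
  · rintro ⟨ha, hb⟩
    refine Set.Subset.antisymm ?_ fun c hc => ⟨_, hb c hc, h4 c⟩
    rintro _ ⟨c, hc, rfl⟩
    exact ha c hc

/-- `Spin(q)(S) = {u ∈ Cl₀(C, q)_S^* | u · C_S · u⁻¹ = C_S and u σ(u) = 1}`. -/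
def Spin : Subgroup (S ⊗[R] CliffordAlgebra.even nq)ˣ where
  carrier := {u |
    (fun c => evenS S (u : S ⊗[R] CliffordAlgebra.even nq) * c *
        evenS S (↑u⁻¹ : S ⊗[R] CliffordAlgebra.even nq)) '' vectors R C S = vectors R C S ∧
      evenS S (u : S ⊗[R] CliffordAlgebra.even nq) *
        sigmaS S (evenS S (u : S ⊗[R] CliffordAlgebra.even nq)) = 1}
  one_mem' := by
    refine ⟨?_, ?_⟩
    · rw [conj_image_eq_iff]
      simp
    · simp [sigmaS_one]
  mul_mem' := by
    rintro a b ⟨ha, ha'⟩ ⟨hb, hb'⟩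
    rw [conj_image_eq_iff] at ha hb
    refine ⟨?_, ?_⟩
    · rw [conj_image_eq_iff]
      refine ⟨fun c hc => ?_, fun c hc => ?_⟩
      · have h := ha.1 _ (hb.1 c hc)
        rw [mul_inv_rev, Units.val_mul, Units.val_mul, map_mul, map_mul]
        simpa only [mul_assoc] using h
      · have h := hb.2 _ (ha.2 c hc)
        rw [mul_inv_rev, Units.val_mul, Units.val_mul, map_mul, map_mul]
        simpa only [mul_assoc] using h
    · rw [Units.val_mul, map_mul, sigmaS_mul, mul_assoc, ← mul_assoc (evenS S b.1), hb', one_mul,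
        ha']
  inv_mem' := by
    rintro a ⟨ha, ha'⟩
    rw [conj_image_eq_iff] at ha
    have h2 : evenS S a⁻¹.1 * evenS S a.1 = 1 := by rw [← map_mul, a.inv_mul, map_one]
    have h3 : sigmaS S (evenS S a.1) = evenS S a⁻¹.1 := (left_inv_eq_right_inv h2 ha').symm
    refine ⟨?_, ?_⟩
    · rw [conj_image_eq_iff]
      exact ⟨fun c hc => by simpa using ha.2 c hc, fun c hc => by simpa using ha.1 c hc⟩
    · rw [← h3, ← sigmaS_mul, h3, h2, sigmaS_one]

/-- `GL(C)(S)`. -/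
abbrev GLPoints := LinearMap.GeneralLinearGroup S (S ⊗[R] C)

/-- `RT'(C)(S)`: the triples `(t₁, t₂, t₃) ∈ O(q)(S)³` such that
`t₁(xy) = \overline{t₂(x̄)} \overline{t₃(ȳ)}` for all `x, y ∈ C_S`. -/
def RT' : Subgroup (GLPoints R C S × GLPoints R C S × GLPoints R C S) where
  carrier := {t |
    (t.1 ∈ (normS (R := R) (C := C) S).orthogonal ∧
      t.2.1 ∈ (normS (R := R) (C := C) S).orthogonal ∧
      t.2.2 ∈ (normS (R := R) (C := C) S).orthogonal) ∧
    ∀ x y : S ⊗[R] C, t.1.1 (x * y) =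
      conjS (R := R) S (t.2.1.1 (conjS (R := R) S x)) *
        conjS (R := R) S (t.2.2.1 (conjS (R := R) S y))}
  one_mem' := ⟨⟨one_mem _, one_mem _, one_mem _⟩, fun x y => by simp [conjS_conjS]⟩
  mul_mem' := by
    rintro a b ⟨⟨a1, a2, a3⟩, ha⟩ ⟨⟨b1, b2, b3⟩, hb⟩
    refine ⟨⟨mul_mem a1 b1, mul_mem a2 b2, mul_mem a3 b3⟩, fun x y => ?_⟩
    have h := ha (conjS (R := R) S (b.2.1.1 (conjS (R := R) S x)))
      (conjS (R := R) S (b.2.2.1 (conjS (R := R) S y)))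
    rw [conjS_conjS, conjS_conjS, ← hb] at h
    exact h
  inv_mem' := by
    rintro a ⟨⟨a1, a2, a3⟩, ha⟩
    refine ⟨⟨inv_mem a1, inv_mem a2, inv_mem a3⟩, fun x y => ?_⟩
    have h := ha (conjS (R := R) S (a.2.1⁻¹.1 (conjS (R := R) S x)))
      (conjS (R := R) S (a.2.2⁻¹.1 (conjS (R := R) S y)))
    have e : ∀ (t : GLPoints R C S) (z : S ⊗[R] C), t.1 (t⁻¹.1 z) = z := fun t z =>
      LinearMap.congr_fun t.mul_inv z
    have e' : ∀ (t : GLPoints R C S) (z : S ⊗[R] C), t⁻¹.1 (t.1 z) = z := fun t z =>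
      LinearMap.congr_fun t.inv_mul z
    rw [conjS_conjS, conjS_conjS, e, e, conjS_conjS, conjS_conjS] at h
    change a.1⁻¹.1 (x * y) = _
    rw [← h, e']
    rfl

/-- `RT(C)(S)`: the related triples `(t₁, t₂, t₃)` with all `tᵢ ∈ SO(q)(S)`. -/
def RT : Subgroup (GLPoints R C S × GLPoints R C S × GLPoints R C S) :=
  RT' R C S ⊓ Subgroup.prod (normS (R := R) (C := C) S).specialOrthogonal
    (Subgroup.prod (normS (R := R) (C := C) S).specialOrthogonal
      (normS (R := R) (C := C) S).specialOrthogonal)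

end Groups

section Functors

variable {R C} {S T U : Type u} [CommRing S] [Algebra R S] [CommRing T] [Algebra R T]
  [CommRing U] [Algebra R U]

theorem evenMap_mem_vectors {S T : Type u} [CommRing S] [Algebra R S] [CommRing T] [Algebra R T]
    (f : S →ₐ[R] T) (a b : S ⊗[R] CliffordAlgebra nq)
    (h : ∀ c ∈ vectors R C S, a * c * b ∈ vectors R C S) :
    ∀ c ∈ vectors R C T, clMap f a * c * clMap f b ∈ vectors R C T := by
  rintro _ ⟨z, rfl⟩
  induction z with
  | zero => exact ⟨0, by simp⟩
  | add z w hz hw =>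
    obtain ⟨z', hz'⟩ := hz
    obtain ⟨w', hw'⟩ := hw
    exact ⟨z' + w', by rw [map_add, hz', hw', map_add, mul_add, add_mul]⟩
  | tmul t x =>
    obtain ⟨y, hy⟩ := h _ ⟨1 ⊗ₜ x, rfl⟩
    refine ⟨t • ScalarChange.map C f y, ?_⟩
    have h1 : t ⊗ₜ[R] x = t • ScalarChange.map C f (1 ⊗ₜ[R] x) := by simp [smul_tmul']
    rw [h1, _root_.map_smul, _root_.map_smul, iotaS_map, iotaS_map, hy, map_mul, map_mul,
      mul_smul_comm, smul_mul_assoc]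

/-- The homomorphism `Spin(q)(S) → Spin(q)(T)` induced by `f : S → T`. -/
def spinMap (f : S →ₐ[R] T) : Spin R C S →* Spin R C T :=
  ((Units.map (evenMap (C := C) f : _ →* _)).comp (Spin R C S).subtype).codRestrict (Spin R C T)
    (by
      rintro ⟨u, hu, hu'⟩
      rw [conj_image_eq_iff] at hu
      have e : evenS T (evenMap f u.1) = clMap f (evenS S u.1) := evenS_evenMap f u.1
      have e' : evenS T (evenMap f u⁻¹.1) = clMap f (evenS S u⁻¹.1) := evenS_evenMap f u⁻¹.1
      refine ⟨?_, ?_⟩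
      · rw [conj_image_eq_iff]
        change (∀ c ∈ vectors R C T, evenS T (evenMap f u.1) * c * evenS T (evenMap f u⁻¹.1) ∈ _) ∧
          ∀ c ∈ vectors R C T, evenS T (evenMap f u⁻¹.1) * c * evenS T (evenMap f u.1) ∈ _
        rw [e, e']
        exact ⟨evenMap_mem_vectors f _ _ hu.1, evenMap_mem_vectors f _ _ hu.2⟩
      · change evenS T (evenMap f u.1) * sigmaS T (evenS T (evenMap f u.1)) = 1
        rw [e, sigmaS_clMap, ← map_mul, hu', map_one])

/-- The homomorphism `RT'(C)(S) → RT'(C)(T)` induced by `f : S → T`. -/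
def rtMap (f : S →ₐ[R] T) : RT' R C S →* RT' R C T :=
  (((ScalarChange.glMap C f).prodMap
    ((ScalarChange.glMap C f).prodMap (ScalarChange.glMap C f))).comp
      (RT' R C S).subtype).codRestrict (RT' R C T) (by
    rintro ⟨t, ⟨h1, h2, h3⟩, h⟩
    refine ⟨⟨ScalarChange.glMap_mem_orthogonal _ f h1, ScalarChange.glMap_mem_orthogonal _ f h2,
      ScalarChange.glMap_mem_orthogonal _ f h3⟩, fun x y => ?_⟩
    change (ScalarChange.glMap C f t.1).1 (x * y) =
      conjS (R := R) T ((ScalarChange.glMap C f t.2.1).1 (conjS (R := R) T x)) *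
        conjS (R := R) T ((ScalarChange.glMap C f t.2.2).1 (conjS (R := R) T y))
    induction x with
    | zero => simp
    | add a b ha hb => rw [add_mul, map_add, map_add, map_add, map_add, add_mul, ha, hb]
    | tmul r x =>
      induction y with
      | zero => simp
      | add a b ha hb => rw [mul_add, map_add, map_add, map_add, map_add, mul_add, ha, hb]
      | tmul s y =>
        have hx : ∀ (r : T) (x : C), r ⊗ₜ[R] x = r • ScalarChange.map C f (1 ⊗ₜ[R] x) := by
          intro r x
          simp [smul_tmul']
        rw [hx r x, hx s y]
        simp only [_root_.map_smul, smul_mul_assoc, mul_smul_comm, conjS_map, ← ScalarChange.map_mul,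
          ScalarChange.glMap_map, h])

theorem spinMap_id : spinMap (C := C) (AlgHom.id R S) = MonoidHom.id _ := by
  refine MonoidHom.ext fun u => Subtype.ext (Units.ext ?_)
  change evenMap (AlgHom.id R S) u.1.1 = u.1.1
  rw [evenMap, Algebra.TensorProduct.map_id, AlgHom.id_apply]

theorem spinMap_comp (f : S →ₐ[R] T) (g : T →ₐ[R] U) :
    spinMap (C := C) (g.comp f) = (spinMap g).comp (spinMap f) := by
  refine MonoidHom.ext fun u => Subtype.ext (Units.ext ?_)
  change evenMap (g.comp f) u.1.1 = evenMap g (evenMap f u.1.1)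
  generalize (u.1.1 : S ⊗[R] CliffordAlgebra.even nq) = z
  induction z with
  | zero => simp
  | tmul s x => simp [evenMap]
  | add a b ha hb => simp [ha, hb]

theorem rtMap_id : rtMap (C := C) (AlgHom.id R S) = MonoidHom.id _ := by
  refine MonoidHom.ext fun t => Subtype.ext ?_
  change (ScalarChange.glMap C (AlgHom.id R S) t.1.1, ScalarChange.glMap C (AlgHom.id R S) t.1.2.1,
    ScalarChange.glMap C (AlgHom.id R S) t.1.2.2) = t.1
  rw [ScalarChange.glMap_id, ScalarChange.glMap_id, ScalarChange.glMap_id]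

theorem rtMap_comp (f : S →ₐ[R] T) (g : T →ₐ[R] U) :
    rtMap (C := C) (g.comp f) = (rtMap g).comp (rtMap f) := by
  refine MonoidHom.ext fun t => Subtype.ext ?_
  change (ScalarChange.glMap C (g.comp f) t.1.1, ScalarChange.glMap C (g.comp f) t.1.2.1,
    ScalarChange.glMap C (g.comp f) t.1.2.2) =
    (ScalarChange.glMap C g (ScalarChange.glMap C f t.1.1),
      ScalarChange.glMap C g (ScalarChange.glMap C f t.1.2.1),
      ScalarChange.glMap C g (ScalarChange.glMap C f t.1.2.2))
  rw [ScalarChange.glMap_comp, ScalarChange.glMap_comp, ScalarChange.glMap_comp]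

variable (R C)

/-- The group scheme `Spin(q_C)`, as a group functor on `R`-rings. -/
def spinFunctor : CommAlgCat.{u} R ⥤ GrpCat.{u} where
  obj S := GrpCat.of (Spin R C S)
  map f := GrpCat.ofHom (spinMap f.hom)
  map_id S := congrArg GrpCat.ofHom (spinMap_id (S := S))
  map_comp f g := congrArg GrpCat.ofHom (spinMap_comp f.hom g.hom)

/-- The group scheme `RT'(C)`, as a group functor on `R`-rings. -/
def rtFunctor : CommAlgCat.{u} R ⥤ GrpCat.{u} where
  obj S := GrpCat.of (RT' R C S)
  map f := GrpCat.ofHom (rtMap f.hom)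
  map_id S := congrArg GrpCat.ofHom (rtMap_id (S := S))
  map_comp f g := congrArg GrpCat.ofHom (rtMap_comp f.hom g.hom)

end Functors

end OctonionAlgebra

/-- A group functor on `R`-rings is an affine group scheme over `R` if its underlying functor is
represented by an `R`-ring. -/
def IsAffineGroupScheme {R : Type u} [CommRing R] (G : CommAlgCat.{u} R ⥤ GrpCat.{u}) : Prop :=
  (G ⋙ forget GrpCat.{u}).IsCorepresentable

end

/-! ### Linear algebra -/

/-! The main point is that `alphaCl`, the map α' : Cl(C, q) → End(C ⊕ C), is an isomorphism. Over a
field, let B be the subalgebra generated by α(C). Left multiplication by a basis of C and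
supercommutators with the polar-dual basis act on B like creation and annihilation operators. Hence
2^8 divides dim B (`two_pow_dvd_finrank_of_superalgebra`). Since B contains 1 and dim End(C ⊕ C) =
16² = 2^8, B is everything. Ordered products of 8 basis vectors bound the dimension of the Clifford
algebra by 2^8, so surjectivity forces bijectivity. Over a general ring, Nakayama's lemma reduces
the claim to residue fields (`LinearMap.bijective_of_residueField`). Separating even and odd parts
turns it into bijectivity of α'', which survives scalar extension.

Triality enters through the cyclic symmetry of the trilinear form b(xy, z̄)
(`polar_mul_conj_cyclic`): the relation defining RT' may be rotated among isometries
(`IsRelated.rotate`). Two of its rotations say exactly that diag(t₃, t₂) intertwines α(x) with α(t₁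
x) (`isRelated_iff_prodMap_mul_alpha`). Thus the even element u with α''(u) = (t₃, t₂) satisfies u x
u⁻¹ = t₁(x). Since α(x) is self-adjoint for b ⊥ b, α' turns σ into the adjoint, and u σ(u) = 1 means
that t₂ and t₃ preserve b. Where 2 is not invertible this is weaker than preserving q; the missing
information comes from multiplicativity of q and the triality relation (`IsRelated.norm_map`).
Triples and spin elements therefore correspond bijectively.

For a related triple, Cl(t₁) is conjugation by u, which fixes the centre of the even Clifford
algebra; rotation treats t₂ and t₃ likewise, so all three lie in SO(q). Finally RT' is cut out by
natural equations in matrix entries, hence affine, and Spin is affine through the isomorphism. -/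

/-- Since D² = 0 and DL + LD = 1 for the last pair, ker D = im D, so the dimension is twice that of
ker D. The other operators anticommute with D and restrict to its kernel, which allows induction. No
relations among the L's are needed. -/
theorem two_pow_dvd_finrank_of_clifford_action {k : Type*} [Field k] (n : ℕ) :
    ∀ (M : Type u) [AddCommGroup M] [Module k M] [FiniteDimensional k M]
      (L D : Fin n → Module.End k M)
      (_ : ∀ i x, D i (L i x) + L i (D i x) = x)
      (_ : ∀ i j, i ≠ j → ∀ x, D i (L j x) + L j (D i x) = 0)
      (_ : ∀ i x, D i (D i x) = 0)
      (_ : ∀ i j x, D i (D j x) + D j (D i x) = 0),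
      2 ^ n ∣ Module.finrank k M := by
  induction n with
  | zero => simp
  | succ n ih =>
    intro M _ _ _ L D h1 h2 h3 h4
    let d := D (Fin.last n)
    have hL : ∀ (i : Fin n) (x : LinearMap.ker d), L i.castSucc x ∈ LinearMap.ker d := by
      intro i x
      have h := h2 (Fin.last n) i.castSucc (Fin.castSucc_lt_last i).ne' x
      have hx : D (Fin.last n) x = 0 := x.2
      rw [hx, map_zero, add_zero] at h
      exact h
    have hD : ∀ (i : Fin n) (x : LinearMap.ker d), D i.castSucc x ∈ LinearMap.ker d := by
      intro i x
      have h := h4 (Fin.last n) i.castSucc x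
      have hx : D (Fin.last n) x = 0 := x.2
      rw [hx, map_zero, add_zero] at h
      exact h
    have hr : LinearMap.range d = LinearMap.ker d := by
      apply le_antisymm
      · rintro _ ⟨x, rfl⟩
        exact h3 _ x
      · intro x hx
        have h := h1 (Fin.last n) x
        have hx' : D (Fin.last n) x = 0 := hx
        rw [hx', map_zero, add_zero] at h
        exact ⟨_, h⟩
    have hdim : Module.finrank k M = Module.finrank k (LinearMap.ker d) * 2 := by
      rw [← d.finrank_range_add_finrank_ker, hr, mul_two]
    rw [hdim, pow_succ]
    refine Nat.mul_dvd_mul_right (ih (LinearMap.ker d)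
      (fun i => (L i.castSucc).restrict fun x hx => hL i ⟨x, hx⟩)
      (fun i => (D i.castSucc).restrict fun x hx => hD i ⟨x, hx⟩) ?_ ?_ ?_ ?_) 2
    · exact fun i x => Subtype.ext (h1 _ _)
    · exact fun i j hij x => Subtype.ext (h2 _ _ (by simpa using hij) _)
    · exact fun i x => Subtype.ext (h3 _ _)
    · exact fun i j x => Subtype.ext (h4 _ _ _)

/-! ### Ordered products of vectors with scalar anticommutators -/

section OrderedProducts

variable {k A : Type*} [CommRing k] [Ring A] [Algebra k A]

/-- The span of the ordered products of sublists of `l`. -/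
def orderedProductSpan (k : Type*) {A : Type*} [CommRing k] [Ring A] [Algebra k A] :
    List A → Submodule k A
  | [] => Submodule.span k {1}
  | v :: l => orderedProductSpan k l ⊔ (orderedProductSpan k l).map (LinearMap.mulLeft k v)

theorem orderedProductSpan_fg (l : List A) : (orderedProductSpan k l).FG := by
  induction l with
  | nil => exact Submodule.fg_span_singleton 1
  | cons v l ih => exact ih.sup (ih.map _)

theorem one_mem_orderedProductSpan (l : List A) : 1 ∈ orderedProductSpan k l := by
  induction l with
  | nil => exact Submodule.mem_span_singleton_self 1
  | cons v l ih => exact Submodule.mem_sup_left ih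

/-- Moving v past the leading factor w costs a sign and a scalar: v(wc) = rc - w(vc). If v is the
leading factor itself, v² is a scalar. Linear independence plays no role. -/
theorem mul_mem_orderedProductSpan (l : List A)
    (h : ∀ v ∈ l, ∀ w ∈ l, ∃ r : k, v * w + w * v = algebraMap k A r)
    (h' : ∀ v ∈ l, ∃ r : k, v * v = algebraMap k A r) :
    ∀ v ∈ l, ∀ a ∈ orderedProductSpan k l, v * a ∈ orderedProductSpan k l := by
  induction l with
  | nil => simp
  | cons w l ih =>
    have ih' := ih (fun v hv w hw => h v (by simp [hv]) w (by simp [hw]))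
      (fun v hv => h' v (by simp [hv]))
    have hl : ∀ a ∈ orderedProductSpan k l, a ∈ orderedProductSpan k (w :: l) :=
      fun a ha => Submodule.mem_sup_left ha
    have hw : ∀ a ∈ orderedProductSpan k l, w * a ∈ orderedProductSpan k (w :: l) :=
      fun a ha => Submodule.mem_sup_right ⟨a, ha, rfl⟩
    intro v hv a ha
    obtain ⟨b, hb, _, ⟨c, hc, rfl⟩, rfl⟩ := Submodule.mem_sup.1 ha
    rw [mul_add]
    rw [List.mem_cons] at hv
    change v * b + v * (w * c) ∈ _
    rcases hv with rfl | hv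
    · refine add_mem (hw b hb) ?_
      obtain ⟨r, hr⟩ := h' v (by simp)
      rw [← mul_assoc, hr, ← Algebra.smul_def]
      exact Submodule.smul_mem _ _ (hl c hc)
    · refine add_mem (hl _ (ih' v hv b hb)) ?_
      obtain ⟨r, hr⟩ := h v (by simp [hv]) w (by simp)
      have e : v * (w * c) = r • c - w * (v * c) := by
        rw [Algebra.smul_def, ← hr]
        noncomm_ring
      rw [e]
      exact sub_mem (Submodule.smul_mem _ _ (hl c hc)) (hw _ (ih' v hv c hc))

theorem finrank_orderedProductSpan_le {k A : Type*} [Field k] [Ring A] [Algebra k A]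
    (l : List A) : Module.finrank k (orderedProductSpan k l) ≤ 2 ^ l.length := by
  induction l with
  | nil => exact (finrank_span_le_card (R := k) ({1} : Set A)).trans (by simp)
  | cons v l ih =>
    have : FiniteDimensional k (orderedProductSpan k l) :=
      Module.Finite.iff_fg.2 (orderedProductSpan_fg l)
    refine (Submodule.finrank_add_le_finrank_add_finrank _ _).trans ?_
    have := Submodule.finrank_map_le (LinearMap.mulLeft k v) (orderedProductSpan k l)
    rw [List.length_cons, pow_succ]
    omega

end OrderedProducts

/-! ### Bijectivity tested on residue fields -/

section ResidueFields

variable {R : Type u} [CommRing R]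

theorem subsingleton_of_residueField_tensor {M : Type*} [AddCommGroup M] [Module R M]
    [Module.Finite R M]
    (h : ∀ p : PrimeSpectrum R, Subsingleton (p.asIdeal.ResidueField ⊗[R] M)) :
    Subsingleton M := by
  rw [← Module.support_eq_empty_iff (R := R), Set.eq_empty_iff_forall_notMem]
  intro p hp
  rw [Module.mem_support_iff_nontrivial_residueField_tensorProduct] at hp
  exact not_subsingleton _ (h p)

/-- Nakayama kills the cokernel. As N is projective, f then splits, so its kernel is a finitely
generated summand that stays a kernel after base change, and Nakayama kills it too. M is only
assumed finite, which is all that is known beforehand of the Clifford algebra. -/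
theorem LinearMap.bijective_of_residueField {M N : Type*} [AddCommGroup M] [Module R M]
    [Module.Finite R M] [AddCommGroup N] [Module R N] [Module.Finite R N] [Module.Projective R N]
    (f : M →ₗ[R] N)
    (h : ∀ m : PrimeSpectrum R,
      Function.Bijective (f.baseChange m.asIdeal.ResidueField)) : Function.Bijective f := by
  have hs : Function.Surjective f := by
    rw [← LinearMap.range_eq_top, ← Submodule.Quotient.subsingleton_iff]
    refine subsingleton_of_residueField_tensor (R := R) fun m => ?_
    have h1 : Function.Surjective
        ((LinearMap.range f).mkQ.baseChange m.asIdeal.ResidueField) :=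
      LinearMap.lTensor_surjective _ (Submodule.mkQ_surjective _)
    refine subsingleton_of_forall_eq 0 fun z => ?_
    obtain ⟨y, rfl⟩ := h1 z
    obtain ⟨x, rfl⟩ := (h m).2 y
    rw [← LinearMap.comp_apply, ← LinearMap.baseChange_comp, LinearMap.range_mkQ_comp,
      LinearMap.baseChange_zero, LinearMap.zero_apply]
  refine ⟨?_, hs⟩
  obtain ⟨s, hs'⟩ := Module.projective_lifting_property f LinearMap.id hs
  -- The projection onto the kernel along the section: it makes the kernel finite, and it keeps the
  -- inclusion of the kernel injective after base change.
  let e : M →ₗ[R] LinearMap.ker f := (LinearMap.id - s ∘ₗ f).codRestrict _ fun x => by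
    have := LinearMap.congr_fun hs' (f x)
    simp only [LinearMap.comp_apply, LinearMap.id_apply] at this
    simp [this]
  have he : ∀ x : LinearMap.ker f, e x = x := fun x => Subtype.ext (by simp [e])
  have : Module.Finite R (LinearMap.ker f) :=
    Module.Finite.of_surjective e fun x => ⟨x, he x⟩
  rw [← LinearMap.ker_eq_bot, ← Submodule.subsingleton_iff_eq_bot]
  refine subsingleton_of_residueField_tensor (R := R) fun m => ?_
  refine subsingleton_of_forall_eq 0 fun z => ?_
  have h1 : e ∘ₗ (LinearMap.ker f).subtype = LinearMap.id := LinearMap.ext he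
  have h2 : (LinearMap.ker f).subtype.baseChange m.asIdeal.ResidueField z = 0 := by
    apply (h m).1
    rw [← LinearMap.comp_apply, ← LinearMap.baseChange_comp, LinearMap.comp_ker_subtype,
      LinearMap.baseChange_zero, LinearMap.zero_apply, map_zero]
  have h3 : (e ∘ₗ (LinearMap.ker f).subtype).baseChange m.asIdeal.ResidueField z = 0 := by
    rw [LinearMap.baseChange_comp, LinearMap.comp_apply, h2, map_zero]
  rwa [h1, LinearMap.baseChange_id] at h3

end ResidueFields

/-! ### Endomorphisms of finitely generated projective modules -/

theorem Module.exists_finite_dual_basis (R M : Type*) [CommRing R] [AddCommGroup M] [Module R M]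
    [Module.Finite R M] [Module.Projective R M] :
    ∃ (n : ℕ) (c : Fin n → M) (g : Fin n → Module.Dual R M), ∀ x, ∑ i, g i x • c i = x := by
  obtain ⟨n, f, g, -, -, h⟩ := Module.Finite.exists_comp_eq_id_of_projective R M
  refine ⟨n, fun i => f (Pi.single i 1), fun i => LinearMap.proj i ∘ₗ g, fun x => ?_⟩
  have h1 := LinearMap.congr_fun h x
  conv_rhs => rw [← LinearMap.id_apply (R := R) x, ← h1, LinearMap.comp_apply,
    pi_eq_sum_univ' (g x), map_sum]
  simp

/-- Evaluation at the generators, f ↦ (f c_j), embeds End M as a direct summand of Mⁿ. -/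
theorem Module.End.finite_and_projective (R M : Type*) [CommRing R] [AddCommGroup M] [Module R M]
    [Module.Finite R M] [Module.Projective R M] :
    Module.Finite R (Module.End R M) ∧ Module.Projective R (Module.End R M) := by
  obtain ⟨n, c, g, h⟩ := Module.exists_finite_dual_basis R M
  let i : Module.End R M →ₗ[R] (Π₀ _ : Fin n, M) :=
    (DFinsupp.linearEquivFunOnFintype (R := R)).symm.toLinearMap ∘ₗ
      LinearMap.pi fun j => LinearMap.applyₗ (c j)
  let s : (Π₀ _ : Fin n, M) →ₗ[R] Module.End R M :=
    ∑ j, LinearMap.smulRightₗ (g j) ∘ₗ DFinsupp.lapply j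
  have hs : s ∘ₗ i = LinearMap.id := by
    refine LinearMap.ext fun f => LinearMap.ext fun x => ?_
    conv_rhs => rw [LinearMap.id_apply, ← h x, map_sum]
    simp only [s, i, LinearMap.comp_apply, LinearMap.sum_apply]
    exact Finset.sum_congr rfl fun j _ => (map_smul f _ _).symm
  exact ⟨Module.Finite.of_surjective s fun f => ⟨i f, LinearMap.congr_fun hs f⟩,
    Module.Projective.of_split i s hs⟩

theorem LinearMap.tensorProductEnd_tmul {R S M : Type*} [CommRing R] [CommRing S]
    [Algebra R S] [AddCommGroup M] [Module R M] (s : S) (f : Module.End R M) :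
    LinearMap.tensorProductEnd R S M (s ⊗ₜ f) = s • f.baseChange S := rfl

/-- The dual basis gives an explicit inverse: φ goes to the sum over i of the rank-one operators
g_i(·) φ(1 ⊗ c_i). -/
theorem LinearMap.tensorProductEnd_bijective (R S M : Type*) [CommRing R] [CommRing S]
    [Algebra R S] [AddCommGroup M] [Module R M] [Module.Finite R M] [Module.Projective R M] :
    Function.Bijective (LinearMap.tensorProductEnd R S M) := by
  obtain ⟨n, c, g, h⟩ := Module.exists_finite_dual_basis R M
  let inv : Module.End S (S ⊗[R] M) → S ⊗[R] Module.End R M := fun φ =>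
    ∑ i, ((LinearMap.smulRightₗ (g i) : M →ₗ[R] Module.End R M).baseChange S) (φ (1 ⊗ₜ c i))
  refine Function.bijective_iff_has_inverse.2 ⟨inv, fun z => ?_, fun φ => ?_⟩
  · induction z with
    | zero => simp [inv]
    | add a b ha hb =>
      simp only [inv, map_add, LinearMap.add_apply, Finset.sum_add_distrib] at ha hb ⊢
      rw [ha, hb]
    | tmul s f =>
      simp only [inv]
      have : f = ∑ i, LinearMap.smulRightₗ (g i) (f (c i)) := by
        ext x
        conv_lhs => rw [← h x]
        simp
      conv_rhs => rw [this]
      rw [TensorProduct.tmul_sum]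
      refine Finset.sum_congr rfl fun i _ => ?_
      rw [LinearMap.tensorProductEnd_tmul, LinearMap.smul_apply, map_smul,
        LinearMap.baseChange_tmul, LinearMap.baseChange_tmul, smul_tmul', smul_eq_mul, mul_one]
  · ext x
    simp only [inv]
    have key : ∀ (i : Fin n) (y : S ⊗[R] M),
        LinearMap.tensorProductEnd R S M
          ((LinearMap.smulRightₗ (g i) : M →ₗ[R] Module.End R M).baseChange S y) (1 ⊗ₜ x) =
        g i x • y := by
      intro i y
      induction y with
      | zero => simp only [map_zero, LinearMap.zero_apply, smul_zero]
      | tmul s m =>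
        rw [LinearMap.baseChange_tmul, LinearMap.tensorProductEnd_tmul, LinearMap.smul_apply,
          LinearMap.baseChange_tmul, smul_tmul', smul_eq_mul, mul_one,
          ← TensorProduct.tmul_smul]
        rfl
      | add a b ha hb => rw [map_add, map_add, LinearMap.add_apply, ha, hb, smul_add]
    simp only [TensorProduct.AlgebraTensorModule.curry_apply, TensorProduct.curry_apply,
      LinearMap.coe_restrictScalars]
    rw [map_sum, LinearMap.sum_apply]
    simp only [key]
    conv_rhs => rw [← h x, TensorProduct.tmul_sum, map_sum]
    simp

/-! ### Octonion algebras -/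

namespace OctonionAlgebra

section Basic

variable {R C : Type u} [CommRing R] [NonAssocRing C] [Module R C]
  [SMulCommClass R C C] [IsScalarTower R C C] [OctonionAlgebra R C]

local notation "nq" => norm (R := R) (C := C)
local notation "bq" => QuadraticMap.polarBilin (norm (R := R) (C := C))

/-- Faithfulness of C comes from the rank: at each maximal ideal the localization of C is free of
rank 8, hence faithful. -/
theorem eq_zero_of_forall_smul_eq_zero (r : R) (h : ∀ x : C, r • x = 0) : r = 0 := by
  refine Module.eq_zero_of_localization_maximal (fun m _ => Localization.AtPrime m)
    (fun m _ => Algebra.linearMap R (Localization.AtPrime m)) r fun m hm => ?_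
  let p : PrimeSpectrum R := ⟨m, hm.isPrime⟩
  have h8 : Module.finrank (Localization.AtPrime m) (LocalizedModule m.primeCompl C) = 8 :=
    rank_eq_eight (R := R) (C := C) p
  have : Nontrivial (LocalizedModule m.primeCompl C) :=
    Module.nontrivial_of_finrank_pos (R := Localization.AtPrime m) (by omega)
  have : Module.Free (Localization.AtPrime m) (LocalizedModule m.primeCompl C) :=
    Module.free_of_flat_of_isLocalRing
  apply FaithfulSMul.eq_of_smul_eq_smul (α := LocalizedModule m.primeCompl C)
  intro z
  rw [zero_smul, Algebra.linearMap_apply, algebraMap_smul]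
  induction z using LocalizedModule.induction_on with
  | h x s => rw [LocalizedModule.smul'_mk, h, LocalizedModule.zero_mk]

theorem eq_of_forall_smul_eq {r s : R} (h : ∀ x : C, r • x = s • x) : r = s :=
  sub_eq_zero.1 (eq_zero_of_forall_smul_eq_zero (C := C) _ fun x => by rw [sub_smul, h, sub_self])

/-- The axioms do not include q(1) = 1. Multiplicativity and regularity give this form of it, and
faithfulness of C then yields `norm_one`. -/
theorem norm_one_smul (x : C) : nq 1 • x = x :=
  eq_of_polar (R := R) fun z => by
    rw [_root_.map_smul, LinearMap.smul_apply, smul_eq_mul, norm_one_mul]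

theorem polar_conj_conj (x y : C) : bq (conj R C x) (conj R C y) = bq x y := by
  simp only [QuadraticMap.polarBilin_apply_apply, QuadraticMap.polar, ← map_add, norm_conj]

theorem polar_conj_left (x y : C) : bq (conj R C x) y = bq x (conj R C y) := by
  rw [← polar_conj_conj, conj_conj]

theorem polar_mul_conj (x y w : C) : bq (x * conj R C y) w = bq x (w * y) := by
  have h := polar_mul_add (R := R) x w y 1
  rw [mul_one, mul_one, polar_comm y 1] at h
  rw [conj_apply, mul_sub, mul_smul_comm, mul_one, map_sub, _root_.map_smul,
    LinearMap.sub_apply, LinearMap.smul_apply, smul_eq_mul]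
  linear_combination -h

theorem conj_mul (x y : C) : conj R C (x * y) = conj R C y * conj R C x := by
  apply eq_of_polar (R := R)
  intro w
  have h1 : bq (conj R C (x * y)) w = bq (conj R C x * conj R C w) y := by
    rw [← mul_one (conj R C (x * y)), polar_conj_mul, polar_conj_mul, ← polar_mul_conj, one_mul]
  rw [h1, polar_mul_conj, polar_conj_mul]

/-- The source of triality: the trilinear form b(xy, z̄) is invariant under cyclic permutations. -/
theorem polar_mul_conj_cyclic (x y z : C) :
    bq (x * y) (conj R C z) = bq (z * x) (conj R C y) := by
  rw [← polar_conj_left (z * x), conj_mul, polar_conj_mul, polar_comm]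

variable (R) in
/-- `t₁ (\overline{x y}) = \overline{t₃(x) t₂(y)}`: the triality relation, in a cyclically
symmetric form. -/
def IsRelated (t₁ t₂ t₃ : C →ₗ[R] C) : Prop :=
  ∀ x y, t₁ (conj R C (x * y)) = conj R C (t₃ x * t₂ y)

/-- When t₁ preserves b, relatedness makes the triple preserve the cyclic trilinear form.
Surjectivity of t₂ permits testing the rotated identity against vectors t₂ z only. -/
theorem IsRelated.rotate {t₁ t₂ t₃ : C →ₗ[R] C} (h : IsRelated R t₁ t₂ t₃)
    (h₁ : ∀ x y, bq (t₁ x) (t₁ y) = bq x y) (h₂ : ∀ x y, bq (t₂ x) (t₂ y) = bq x y)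
    (hs : Function.Surjective t₂) : IsRelated R t₂ t₃ t₁ := by
  intro x y
  apply eq_of_polar (R := R)
  intro w
  obtain ⟨z, rfl⟩ := hs w
  rw [h₂, polar_conj_left, polar_conj_left, polar_mul_conj_cyclic, polar_mul_conj_cyclic,
    polar_mul_conj_cyclic (t₁ x), polar_mul_conj_cyclic (t₂ z), ← polar_conj_left,
    ← polar_conj_left (t₃ y * t₂ z), ← h, h₁]

/-- The two off-diagonal blocks of the intertwining identity are the two rotations of the triality
relation. -/
theorem isRelated_iff_prodMap_mul_alpha {t₁ t₂ t₃ : C →ₗ[R] C} :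
    (∀ x, t₃.prodMap t₂ * alpha R C x = alpha R C (t₁ x) * t₃.prodMap t₂) ↔
      IsRelated R t₂ t₃ t₁ ∧ IsRelated R t₃ t₁ t₂ := by
  constructor
  · intro h
    refine ⟨fun x y => ?_, fun x y => ?_⟩
    · exact congrArg Prod.snd (LinearMap.congr_fun (h x) (y, 0))
    · have := congrArg Prod.fst (LinearMap.congr_fun (h y) (0, x))
      rw [conj_mul, conj_mul]
      exact this
  · rintro ⟨h, h'⟩ x
    refine LinearMap.ext fun p => Prod.ext ?_ (h x p.1)
    have := h' p.2 x
    rw [conj_mul, conj_mul] at this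
    exact this

variable (R C) in
theorem exists_polar_dual_basis :
    ∃ (n : ℕ) (c f : Fin n → C), ∀ x, ∑ i, bq x (f i) • c i = x := by
  obtain ⟨n, c, g, h⟩ := Module.exists_finite_dual_basis R C
  choose f hf using fun i => (regular (R := R) (C := C)).2 (g i)
  refine ⟨n, c, f, fun x => ?_⟩
  simp only [polar_comm x]
  conv_rhs => rw [← h x]
  exact Finset.sum_congr rfl fun i _ => by rw [hf]

end Basic

/-! ### Scalar extension of an octonion algebra -/

section BaseChange

variable {R C : Type u} [CommRing R] [NonAssocRing C] [Module R C]
  [SMulCommClass R C C] [IsScalarTower R C C] [OctonionAlgebra R C]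
variable (S : Type u) [CommRing S] [Algebra R S]

local notation "nq" => norm (R := R) (C := C)
local notation "bq" => QuadraticMap.polarBilin (norm (R := R) (C := C))

theorem normS_one_tmul (x : C) : normS (R := R) S (1 ⊗ₜ[R] x) = algebraMap R S (nq x) :=
  QuadraticForm.scalarExtension_one_tmul _ _ _

theorem polar_normS_one_tmul (x y : C) :
    (normS (R := R) (C := C) S).polarBilin (1 ⊗ₜ x) (1 ⊗ₜ y) = algebraMap R S (bq x y) := by
  rw [QuadraticMap.polarBilin_apply_apply, QuadraticMap.polar, ← tmul_add, normS_one_tmul,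
    normS_one_tmul, normS_one_tmul, ← map_sub, ← map_sub]
  rfl

theorem normS_mul (z w : S ⊗[R] C) :
    normS (R := R) S (z * w) = normS (R := R) S z * normS (R := R) S w := by
  have h1 : ∀ (x : C) (w : S ⊗[R] C),
      normS (R := R) S ((1 ⊗ₜ x) * w) = algebraMap R S (nq x) * normS (R := R) S w := by
    intro x w
    have : (normS (R := R) (C := C) S).comp (LinearMap.mulLeft S (1 ⊗ₜ[R] x)) =
        algebraMap R S (nq x) • normS (R := R) (C := C) S := by
      apply baseChange_ext
      intro y
      rw [QuadraticMap.comp_apply, LinearMap.mulLeft_apply, Algebra.TensorProduct.tmul_mul_tmul,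
        mul_one, smul_apply, normS_one_tmul, normS_one_tmul, norm_mul, map_mul,
        smul_eq_mul]
    exact congrArg (fun Q => Q w) this
  have : (normS (R := R) (C := C) S).comp (LinearMap.mulRight S w) =
      normS (R := R) S w • normS (R := R) (C := C) S := by
    apply baseChange_ext
    intro x
    rw [QuadraticMap.comp_apply, LinearMap.mulRight_apply, h1, smul_apply,
      normS_one_tmul, smul_eq_mul, mul_comm]
  rw [mul_comm (normS (R := R) S z)]
  exact congrArg (fun Q => Q z) this

theorem sum_polar_normS {n : ℕ} {c f : Fin n → C} (h : ∀ x, ∑ i, bq x (f i) • c i = x)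
    (z : S ⊗[R] C) :
    ∑ i, (normS (R := R) (C := C) S).polarBilin z (1 ⊗ₜ f i) • ((1 : S) ⊗ₜ[R] c i) = z := by
  induction z with
  | zero => simp only [map_zero, LinearMap.zero_apply, zero_smul, Finset.sum_const_zero]
  | add a b ha hb =>
    simp only [map_add, LinearMap.add_apply, add_smul, Finset.sum_add_distrib]
    rw [ha, hb]
  | tmul s x =>
    have h1 : s ⊗ₜ[R] x = s • ((1 : S) ⊗ₜ[R] x) := by simp [smul_tmul']
    simp only [h1, map_smul, LinearMap.smul_apply, polar_normS_one_tmul, smul_assoc]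
    rw [← Finset.smul_sum]
    congr 1
    conv_rhs => rw [← h x, tmul_sum]
    exact Finset.sum_congr rfl fun i _ => by rw [algebraMap_smul, tmul_smul]

/-- A dual basis whose linear forms are written b(·, f_i) remains one over S, and it exhibits an
inverse of the polar map. -/
theorem normS_regular :
    Function.Bijective
      ((normS (R := R) (C := C) S).polarBilin : S ⊗[R] C → Module.Dual S (S ⊗[R] C)) := by
  obtain ⟨n, c, f, h⟩ := exists_polar_dual_basis R C
  constructor
  · rw [injective_iff_map_eq_zero]
    intro z hz
    rw [← sum_polar_normS S h z, hz]
    simp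
  · intro φ
    refine ⟨∑ i, φ (1 ⊗ₜ c i) • (1 ⊗ₜ f i), LinearMap.ext fun w => ?_⟩
    conv_rhs => rw [← sum_polar_normS S h w]
    rw [map_sum, map_sum, LinearMap.sum_apply]
    refine Finset.sum_congr rfl fun i _ => ?_
    rw [map_smul, map_smul, LinearMap.smul_apply, smul_eq_mul, smul_eq_mul, mul_comm]
    congr 1
    exact QuadraticMap.polar_comm _ _ _

variable (R C) in
/-- The octonion algebra `C_S` over `S`. -/
noncomputable abbrev baseChange : OctonionAlgebra S (S ⊗[R] C) where
  norm := normS (R := R) (C := C) S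
  finite := inferInstance
  projective := inferInstance
  rank_eq_eight p := by
    rw [Module.rankAtStalk_baseChange]
    exact rank_eq_eight _
  norm_mul := normS_mul S
  regular := normS_regular S

attribute [local instance] baseChange

theorem conj_baseChange (z : S ⊗[R] C) : conj S (S ⊗[R] C) z = conjS (R := R) S z := by
  induction z with
  | zero => simp
  | add a b ha hb => rw [map_add, map_add, ha, hb]
  | tmul s x =>
    have h1 : s ⊗ₜ[R] x = s • ((1 : S) ⊗ₜ[R] x) := by simp [smul_tmul']
    rw [h1, map_smul, map_smul]
    congr 1
    rw [conj_apply, conjS, LinearMap.baseChange_tmul, conj_apply, tmul_sub, tmul_smul]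
    congr 1
    rw [← algebraMap_smul S (bq 1 x)]
    congr 1
    exact polar_normS_one_tmul S 1 x

end BaseChange

end OctonionAlgebra

/-! ### Dimension bounds for Clifford-type algebras -/

/-- With θ as grading automorphism, the supercommutator D_i(x) = f_i x - θ(x) f_i is an odd
derivation, and `hef`, `hef'` fix its values on the e_j. The operators D_i D_j + D_j D_i and D_i²
are commutators with f_i f_j + f_j f_i and f_i², which are scalars, so they vanish. -/
theorem two_pow_dvd_finrank_of_superalgebra {k : Type*} {B : Type u} [Field k] [Ring B]
    [Algebra k B] [FiniteDimensional k B] {n : ℕ} (e f : Fin n → B) (θ : B →ₐ[k] B)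
    (hef : ∀ i, f i * e i + e i * f i = 1)
    (hef' : ∀ i j, i ≠ j → f i * e j + e j * f i = 0)
    (hf : ∀ i, ∃ r, f i * f i = algebraMap k B r)
    (hf' : ∀ i j, ∃ r, f i * f j + f j * f i = algebraMap k B r)
    (he : ∀ i, θ (e i) = -e i) (hθ : ∀ i, θ (f i) = -f i) (hθθ : ∀ x, θ (θ x) = x) :
    2 ^ n ∣ Module.finrank k B := by
  let D : Fin n → Module.End k B := fun i =>
    LinearMap.mulLeft k (f i) - LinearMap.mulRight k (f i) ∘ₗ θ.toLinearMap
  have hD : ∀ i x, D i x = f i * x - θ x * f i := fun i x => rfl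
  have hDL : ∀ i j x, D i (e j * x) + e j * D i x = (f i * e j + e j * f i) * x := by
    intro i j x
    rw [hD, hD, map_mul, he]
    noncomm_ring
  have hDD : ∀ i j x, D i (D j x) =
      f i * f j * x - f i * θ x * f j + f j * θ x * f i - x * (f j * f i) := by
    intro i j x
    simp only [hD, map_sub, map_mul, hθ, hθθ]
    noncomm_ring
  refine two_pow_dvd_finrank_of_clifford_action n B (fun i => LinearMap.mulLeft k (e i)) D
    ?_ ?_ ?_ ?_
  · intro i x
    exact (hDL i i x).trans (by rw [hef, one_mul])
  · intro i j hij x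
    exact (hDL i j x).trans (by rw [hef' i j hij, zero_mul])
  · intro i x
    obtain ⟨r, hr⟩ := hf i
    rw [hDD, hr, Algebra.commutes]
    abel
  · intro i j x
    obtain ⟨r, hr⟩ := hf' i j
    have h : D i (D j x) + D j (D i x) =
        (f i * f j + f j * f i) * x - x * (f i * f j + f j * f i) := by
      rw [hDD, hDD]
      noncomm_ring
    rw [h, hr, Algebra.commutes, sub_self]

/-- An abstract A lets the lemma serve both Cl(Q) and the scalar extension Cl(C, q)_k, without
identifying the latter with the Clifford algebra of q_k. -/
theorem orderedProductSpan_eq_top {k A V : Type*} [CommRing k] [Ring A] [Algebra k A]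
    [AddCommGroup V] [Module k V] (Q : QuadraticForm k V) (a : V →ₗ[k] A)
    (ha : ∀ v, a v * a v = algebraMap k A (Q v)) {n : ℕ} (c : Fin n → V)
    (hc : Submodule.span k (Set.range c) = ⊤)
    (hA : ∀ N : Submodule k A, 1 ∈ N → (∀ v, ∀ x ∈ N, a v * x ∈ N) → N = ⊤) :
    orderedProductSpan k (List.ofFn fun i => a (c i)) = ⊤ := by
  refine hA _ (one_mem_orderedProductSpan _) fun v x hx => ?_
  have hv : v ∈ Submodule.span k (Set.range c) := hc ▸ Submodule.mem_top
  induction hv using Submodule.span_induction with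
  | zero => rw [map_zero, zero_mul]; exact zero_mem _
  | add v w _ _ hv hw => rw [map_add, add_mul]; exact add_mem hv hw
  | smul r v _ hv => rw [map_smul, smul_mul_assoc]; exact Submodule.smul_mem _ _ hv
  | mem v hv =>
    obtain ⟨i, rfl⟩ := hv
    refine mul_mem_orderedProductSpan _ ?_ ?_ _ (List.mem_ofFn.2 ⟨i, rfl⟩) x hx
    · intro v hv w hw
      obtain ⟨i, rfl⟩ := List.mem_ofFn.1 hv
      obtain ⟨j, rfl⟩ := List.mem_ofFn.1 hw
      exact ⟨_, CliffordAlgebra.mul_add_swap_eq_polar_of_forall_mul_self_eq a ha _ _⟩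
    · intro v hv
      obtain ⟨i, rfl⟩ := List.mem_ofFn.1 hv
      exact ⟨_, ha _⟩

theorem CliffordAlgebra.submodule_eq_top {R M : Type*} [CommRing R] [AddCommGroup M] [Module R M]
    {Q : QuadraticForm R M} (N : Submodule R (CliffordAlgebra Q)) (h1 : 1 ∈ N)
    (h : ∀ v, ∀ x ∈ N, CliffordAlgebra.ι Q v * x ∈ N) : N = ⊤ := by
  refine eq_top_iff.2 fun x _ => ?_
  induction x using CliffordAlgebra.left_induction with
  | algebraMap r => rw [Algebra.algebraMap_eq_smul_one]; exact N.smul_mem _ h1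
  | add x y hx hy => exact add_mem (hx trivial) (hy trivial)
  | ι_mul x m hx => exact h _ _ (hx trivial)

theorem CliffordAlgebra.finite {R M : Type*} [CommRing R] [AddCommGroup M] [Module R M]
    [Module.Finite R M] (Q : QuadraticForm R M) : Module.Finite R (CliffordAlgebra Q) := by
  obtain ⟨n, c, hc⟩ := Module.Finite.exists_fin (R := R) (M := M)
  refine ⟨?_⟩
  rw [← orderedProductSpan_eq_top Q (CliffordAlgebra.ι Q) (CliffordAlgebra.ι_sq_scalar Q) c hc
    CliffordAlgebra.submodule_eq_top]
  exact orderedProductSpan_fg _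

theorem AlgHom.injective_of_surjective_of_finrank_eq {k A B : Type*} [Field k] [Ring A]
    [Algebra k A] [Ring B] [Algebra k B] [FiniteDimensional k A] (f : A →ₐ[k] B)
    (hs : Function.Surjective f) (h : Module.finrank k A = Module.finrank k B) :
    Function.Injective f := by
  have hi := LinearMap.finrank_range_add_finrank_ker f.toLinearMap
  rw [LinearMap.range_eq_top.2 hs, finrank_top, h, add_eq_left, Submodule.finrank_eq_zero,
    LinearMap.ker_eq_bot] at hi
  exact hi

/-! ### The image of α' over a field -/

namespace OctonionAlgebra

section Field

variable {R C : Type u} [CommRing R] [NonAssocRing C] [Module R C]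
  [SMulCommClass R C C] [IsScalarTower R C C] [OctonionAlgebra R C]

local notation "nq" => norm (R := R) (C := C)
local notation "bq" => QuadraticMap.polarBilin (norm (R := R) (C := C))

theorem alphaCl_ι (x : C) : alphaCl R C (CliffordAlgebra.ι nq x) = alpha R C x :=
  CliffordAlgebra.lift_ι_apply _ _ _

theorem alpha_mul_self (x : C) :
    alpha R C x * alpha R C x = algebraMap R (Module.End R (C × C)) (nq x) := by
  rw [← alphaCl_ι, ← map_mul, CliffordAlgebra.ι_sq_scalar, AlgHom.commutes]

theorem alpha_mul_add_swap (x y : C) : alpha R C x * alpha R C y + alpha R C y * alpha R C x =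
    algebraMap R (Module.End R (C × C)) (bq x y) :=
  CliffordAlgebra.mul_add_swap_eq_polar_of_forall_mul_self_eq (Q := nq) _ alpha_mul_self _ _

variable (R C) in
/-- Conjugation of operators on `C ⊕ C` by `diag(1, -1)`. -/
noncomputable def gradingConj : Module.End R (C × C) ≃ₐ[R] Module.End R (C × C) :=
  ((LinearEquiv.refl R C).prodCongr (LinearEquiv.neg R)).conjAlgEquiv R

theorem gradingConj_gradingConj (φ : Module.End R (C × C)) :
    gradingConj R C (gradingConj R C φ) = φ := by
  refine LinearMap.ext fun p => Prod.ext ?_ ?_ <;> simp [gradingConj]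

theorem gradingConj_alpha (x : C) : gradingConj R C (alpha R C x) = -alpha R C x := by
  refine LinearMap.ext fun p => Prod.ext ?_ ?_ <;> simp [gradingConj, alpha_apply]

theorem finrank_eq_eight {k C : Type u} [Field k] [NonAssocRing C] [Module k C]
    [SMulCommClass k C C] [IsScalarTower k C C] [OctonionAlgebra k C] :
    Module.finrank k C = 8 := by
  rw [← rank_eq_eight (R := k) (C := C) ⊥, Module.rankAtStalk_eq_finrank_of_free]
  rfl

theorem finrank_end_prod {k C : Type u} [Field k] [NonAssocRing C] [Module k C]
    [SMulCommClass k C C] [IsScalarTower k C C] [OctonionAlgebra k C] :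
    Module.finrank k (Module.End k (C × C)) = 256 := by
  exact (Module.finrank_linearMap k k (C × C) (C × C)).trans
    (by rw [Module.finrank_prod, finrank_eq_eight])

/-- Conjugation by diag(1, -1) negates every α(x), so it grades the generated subalgebra. The
superalgebra lemma then makes its dimension a multiple of 256, the dimension of the whole
endomorphism algebra. -/
theorem adjoin_range_alpha {k C : Type u} [Field k] [NonAssocRing C] [Module k C]
    [SMulCommClass k C C] [IsScalarTower k C C] [OctonionAlgebra k C] :
    Algebra.adjoin k (Set.range (alpha k C)) = ⊤ := by
  set B := Algebra.adjoin k (Set.range (alpha k C))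
  have hB : ∀ x, alpha k C x ∈ B := fun x => Algebra.subset_adjoin ⟨x, rfl⟩
  let a : C → B := fun x => ⟨alpha k C x, hB x⟩
  have hθ : ∀ φ : B, gradingConj k C φ ∈ B := by
    have : B ≤ B.comap (gradingConj k C).toAlgHom := by
      refine Algebra.adjoin_le ?_
      rintro _ ⟨x, rfl⟩
      change gradingConj k C (alpha k C x) ∈ B
      rw [gradingConj_alpha]
      exact neg_mem (hB x)
    exact fun φ => this φ.2
  let θ : B →ₐ[k] B := ((gradingConj k C).toAlgHom.comp B.val).codRestrict B hθ
  let b := Module.finBasisOfFinrankEq k C finrank_eq_eight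
  -- The polar-dual basis: b(f_i, b_j) is 1 if i = j and 0 otherwise.
  choose f hf using fun i => (regular (R := k) (C := C)).2 (b.coord i)
  have ha : ∀ x y : C, a x * a y + a y * a x = algebraMap k B (norm.polarBilin x y) :=
    fun x y => Subtype.ext (alpha_mul_add_swap x y)
  have hd : 2 ^ 8 ∣ Module.finrank k B := by
    refine two_pow_dvd_finrank_of_superalgebra (fun i => a (b i)) (fun i => a (f i)) θ
      ?_ ?_ ?_ ?_ ?_ ?_ ?_
    · intro i
      rw [ha, hf, b.coord_apply, b.repr_self, Finsupp.single_eq_same, map_one]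
    · intro i j hij
      rw [ha, hf, b.coord_apply, b.repr_self, Finsupp.single_eq_of_ne hij, map_zero]
    · exact fun i => ⟨_, Subtype.ext (alpha_mul_self _)⟩
    · exact fun i j => ⟨_, ha _ _⟩
    · exact fun i => Subtype.ext (gradingConj_alpha _)
    · exact fun i => Subtype.ext (gradingConj_alpha _)
    · exact fun x => Subtype.ext (gradingConj_gradingConj _)
  have : Nontrivial C := Module.nontrivial_of_finrank_pos (R := k) (by rw [finrank_eq_eight]; omega)
  -- Divisibility alone would allow dimension 0; it is excluded because 1 ≠ 0 lies in B.
  have hpos : 0 < Module.finrank k (Subalgebra.toSubmodule B) :=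
    Submodule.one_le_finrank_iff.2 fun h0 => one_ne_zero (α := Module.End k (C × C))
      ((Submodule.mem_bot k).1 (h0 ▸ one_mem B))
  have h1 := Nat.le_of_dvd hpos hd
  have h2 := Submodule.finrank_le B.toSubmodule
  rw [finrank_end_prod] at h2
  apply Algebra.toSubmodule_eq_top.1
  apply Submodule.eq_top_of_finrank_eq
  rw [finrank_end_prod]
  exact le_antisymm h2 h1

end Field

/-! ### Bijectivity of α' and α'' over every base -/

section BaseChange

variable {R C : Type u} [CommRing R] [NonAssocRing C] [Module R C]
  [SMulCommClass R C C] [IsScalarTower R C C] [OctonionAlgebra R C]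
variable (S : Type u) [CommRing S] [Algebra R S]

local notation "nq" => norm (R := R) (C := C)

attribute [local instance] baseChange

theorem iotaS_mul_self (z : S ⊗[R] C) :
    iotaS S z * iotaS S z = algebraMap S (S ⊗[R] CliffordAlgebra nq) (normS (R := R) S z) := by
  have : LinearMap.BilinMap.toQuadraticMap ((LinearMap.mul S (S ⊗[R] CliffordAlgebra nq)).compl₁₂
      (iotaS (R := R) (C := C) S) (iotaS (R := R) (C := C) S)) =
      (Algebra.linearMap S (S ⊗[R] CliffordAlgebra nq)).compQuadraticMap (normS (R := R) (C := C) S) := by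
    refine baseChange_ext fun x : C => ?_
    change iotaS S (1 ⊗ₜ[R] x) * iotaS S (1 ⊗ₜ[R] x) =
      algebraMap S _ (normS (R := R) S (1 ⊗ₜ[R] x))
    rw [normS_one_tmul, iotaS, LinearMap.baseChange_tmul, Algebra.TensorProduct.tmul_mul_tmul,
      CliffordAlgebra.ι_sq_scalar, Algebra.TensorProduct.algebraMap_apply, mul_one,
      Algebra.algebraMap_self_apply, Algebra.algebraMap_eq_smul_one, Algebra.algebraMap_eq_smul_one,
      tmul_smul, smul_tmul']
  exact congrArg (fun Q => Q z) this

theorem submodule_tensor_clifford_eq_top (N : Submodule S (S ⊗[R] CliffordAlgebra nq))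
    (h1 : 1 ∈ N) (h : ∀ v, ∀ x ∈ N, iotaS S v * x ∈ N) : N = ⊤ := by
  have key : ∀ u : CliffordAlgebra nq, (1 : S) ⊗ₜ u ∈ N := by
    intro u
    induction u using CliffordAlgebra.left_induction with
    | algebraMap r =>
      rw [Algebra.algebraMap_eq_smul_one, tmul_smul, ← algebraMap_smul S r]
      exact N.smul_mem _ h1
    | add x y hx hy => rw [tmul_add]; exact add_mem hx hy
    | ι_mul x m hx =>
      have := h (1 ⊗ₜ m) _ hx
      rwa [iotaS, LinearMap.baseChange_tmul, Algebra.TensorProduct.tmul_mul_tmul, mul_one] at this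
  refine eq_top_iff.2 fun z _ => ?_
  induction z with
  | zero => exact zero_mem _
  | add a b ha hb => exact add_mem (ha trivial) (hb trivial)
  | tmul s u =>
    have h1 : s ⊗ₜ[R] u = s • ((1 : S) ⊗ₜ[R] u) := by simp [smul_tmul']
    rw [h1]
    exact N.smul_mem _ (key u)

variable (R C) in
/-- The homomorphism `α'_S : Cl(C, q)_S → End_S(C_S ⊕ C_S)`. -/
noncomputable def alphaClS : S ⊗[R] CliffordAlgebra nq →ₐ[S] Module.End S ((S ⊗[R] C) × (S ⊗[R] C)) :=
  (((TensorProduct.prodRight R S S C C).conjAlgEquiv S).toAlgHom.comp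
    (LinearMap.tensorProductEnd R S (C × C))).comp
      (Algebra.TensorProduct.map (AlgHom.id S S) (alphaCl R C))

variable {S}

theorem alphaClS_tmul_apply (s : S) (u : CliffordAlgebra nq) (p : (S ⊗[R] C) × (S ⊗[R] C)) :
    alphaClS R C S (s ⊗ₜ u) p = TensorProduct.prodRight R S S C C
      (s • (alphaCl R C u).baseChange S ((TensorProduct.prodRight R S S C C).symm p)) := rfl

theorem linearMap_ext_one_tmul {N : Type*} [AddCommMonoid N] [Module S N] {φ ψ : S ⊗[R] C →ₗ[S] N}
    (h : ∀ x : C, φ (1 ⊗ₜ x) = ψ (1 ⊗ₜ x)) : φ = ψ := by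
  refine LinearMap.ext fun z => ?_
  induction z with
  | zero => rw [map_zero, map_zero]
  | add a b ha hb => rw [map_add, map_add, ha, hb]
  | tmul s x =>
    have h1 : s ⊗ₜ[R] x = s • ((1 : S) ⊗ₜ[R] x) := by simp [smul_tmul']
    rw [h1, map_smul, map_smul, h]

theorem prod_end_ext {φ ψ : Module.End S ((S ⊗[R] C) × (S ⊗[R] C))}
    (h : ∀ a b : C, φ (1 ⊗ₜ a, 1 ⊗ₜ b) = ψ (1 ⊗ₜ a, 1 ⊗ₜ b)) : φ = ψ := by
  have h1 : ∀ a : C, φ (1 ⊗ₜ a, 0) = ψ (1 ⊗ₜ a, 0) := fun a => by simpa using h a 0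
  have h2 : ∀ a : C, φ (0, 1 ⊗ₜ a) = ψ (0, 1 ⊗ₜ a) := fun a => by simpa using h 0 a
  apply LinearMap.prod_ext
  · exact linearMap_ext_one_tmul h1
  · exact linearMap_ext_one_tmul h2

/-- This makes everything proved about α available for C_S, regarded as an octonion algebra over S.
-/
theorem alphaClS_iotaS (z : S ⊗[R] C) : alphaClS R C S (iotaS S z) = alpha S (S ⊗[R] C) z := by
  suffices h : (alphaClS R C S).toLinearMap ∘ₗ iotaS (R := R) (C := C) S = alpha S (S ⊗[R] C) from
    LinearMap.congr_fun h z
  refine linearMap_ext_one_tmul fun x => prod_end_ext fun a b => ?_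
  change alphaClS R C S (1 ⊗ₜ CliffordAlgebra.ι nq x) _ = _
  rw [alphaClS_tmul_apply, alphaCl_ι, TensorProduct.prodRight_symm_tmul, one_smul,
    LinearMap.baseChange_tmul, TensorProduct.prodRight_tmul, alpha_apply, alpha_apply,
    conj_baseChange, conj_baseChange, conj_baseChange, Algebra.TensorProduct.tmul_mul_tmul]
  simp only [conjS, LinearMap.baseChange_tmul, Algebra.TensorProduct.tmul_mul_tmul, mul_one]

set_option maxHeartbeats 1000000 in
theorem alphaClS_bijective_iff :
    Function.Bijective (alphaClS R C S) ↔
      Function.Bijective ((alphaCl R C).toLinearMap.baseChange S) := by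
  change Function.Bijective (((TensorProduct.prodRight R S S C C).conjAlgEquiv S) ∘
    (LinearMap.tensorProductEnd R S (C × C)) ∘ ((alphaCl R C).toLinearMap.baseChange S)) ↔ _
  rw [Function.Bijective.of_comp_iff' (AlgEquiv.bijective _),
    Function.Bijective.of_comp_iff' (LinearMap.tensorProductEnd_bijective R S (C × C))]

/-- The image contains the generators α(C_k), hence everything. Ordered products of 8 basis vectors
bound the source by dimension 2^8, which is the dimension of the target. -/
theorem alphaClS_bijective_of_field (k : Type u) [Field k] [Algebra R k] :
    Function.Bijective (alphaClS R C k) := by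
  have hs : Function.Surjective (alphaClS R C k) := by
    rw [← AlgHom.range_eq_top, eq_top_iff, ← adjoin_range_alpha]
    refine Algebra.adjoin_le ?_
    rintro _ ⟨z, rfl⟩
    exact ⟨iotaS k z, alphaClS_iotaS z⟩
  let b := Module.finBasisOfFinrankEq k (k ⊗[R] C) finrank_eq_eight
  have htop := orderedProductSpan_eq_top (normS (R := R) (C := C) k) (iotaS k)
    (iotaS_mul_self k) b b.span_eq (submodule_tensor_clifford_eq_top k)
  have hle := finrank_orderedProductSpan_le (k := k) (List.ofFn fun i => iotaS (R := R) k (b i))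
  have hfg := orderedProductSpan_fg (k := k) (List.ofFn fun i => iotaS (R := R) k (b i))
  rw [htop] at hle hfg
  have : FiniteDimensional k (k ⊗[R] CliffordAlgebra nq) := ⟨hfg⟩
  rw [finrank_top, List.length_ofFn] at hle
  have hge := LinearMap.finrank_le_finrank_of_surjective (f := (alphaClS R C k).toLinearMap) hs
  rw [finrank_end_prod] at hge
  have heq : Module.finrank k (k ⊗[R] CliffordAlgebra nq) =
      Module.finrank k (Module.End k ((k ⊗[R] C) × (k ⊗[R] C))) := by
    rw [finrank_end_prod]
    exact le_antisymm hle hge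
  have hi := @AlgHom.injective_of_surjective_of_finrank_eq k (k ⊗[R] CliffordAlgebra nq)
    (Module.End k ((k ⊗[R] C) × (k ⊗[R] C))) _ _ _ _ _ _ (alphaClS R C k) hs heq
  exact ⟨hi, hs⟩

variable (R C) in
theorem alphaCl_bijective : Function.Bijective (alphaCl R C) := by
  have : Module.Finite R (CliffordAlgebra nq) := CliffordAlgebra.finite _
  obtain ⟨_, _⟩ := Module.End.finite_and_projective R (C × C)
  exact LinearMap.bijective_of_residueField (alphaCl R C).toLinearMap fun p =>
    alphaClS_bijective_iff.1 (alphaClS_bijective_of_field p.asIdeal.ResidueField)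

variable (R C S) in
theorem alphaClS_bijective : Function.Bijective (alphaClS R C S) := by
  rw [alphaClS_bijective_iff]
  let e : CliffordAlgebra nq ≃ₗ[R] Module.End R (C × C) :=
    LinearEquiv.ofBijective (alphaCl R C).toLinearMap (alphaCl_bijective R C)
  exact (e.baseChange R S _ _).bijective

theorem alphaCl_odd {u : CliffordAlgebra nq} (hu : u ∈ CliffordAlgebra.evenOdd nq 1) :
    (∀ a : C, (alphaCl R C u (a, 0)).1 = 0) ∧ ∀ b : C, (alphaCl R C u (0, b)).2 = 0 := by
  induction u, hu using CliffordAlgebra.odd_induction nq with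
  | ι v => simp [alphaCl_ι, alpha_apply]
  | add x y hx hy ihx ihy => exact ⟨fun a => by simp [ihx.1 a, ihy.1 a],
      fun b => by simp [ihx.2 b, ihy.2 b]⟩
  | ι_mul_ι_mul m₁ m₂ x hx ih =>
    refine ⟨fun a => ?_, fun b => ?_⟩
    · simp [map_mul, alphaCl_ι, alpha_apply, Module.End.mul_apply, ih.1 a]
    · simp [map_mul, alphaCl_ι, alpha_apply, Module.End.mul_apply, ih.2 b]

theorem alphaCl_even_eq_prodMap (u : CliffordAlgebra.even nq) :
    alphaCl R C u = (alphaEven R C u).1.prodMap (alphaEven R C u).2 :=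
  LinearMap.ext fun p => alphaCl_eq_diagonal u p.1 p.2

variable (R C) in
-- For surjectivity, take a preimage of diag(f, g) under α' and drop its odd part: odd elements act
-- by off-diagonal blocks, so the even part already has diagonal blocks f and g.
theorem alphaEven_bijective : Function.Bijective (alphaEven R C) := by
  constructor
  · intro u v h
    apply Subtype.ext
    apply (alphaCl_bijective R C).1
    rw [alphaCl_even_eq_prodMap, alphaCl_even_eq_prodMap, h]
  · rintro ⟨f, g⟩
    obtain ⟨u, hu⟩ := (alphaCl_bijective R C).2 (f.prodMap g)
    obtain ⟨x, y, hxy⟩ : ∃ (x : CliffordAlgebra.evenOdd nq 0) (y : CliffordAlgebra.evenOdd nq 1),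
        (x : CliffordAlgebra nq) + y = u := by
      have h := (CliffordAlgebra.evenOdd_isCompl nq).sup_eq_top
      obtain ⟨x, hx, y, hy, h⟩ := Submodule.mem_sup.1 (h ▸ Submodule.mem_top : u ∈ _)
      exact ⟨⟨x, hx⟩, ⟨y, hy⟩, h⟩
    have hy := alphaCl_odd y.2
    let x' : CliffordAlgebra.even nq := ⟨x, x.2⟩
    have hx : ∀ p, alphaCl R C x p = ((alphaEven R C x').1 p.1, (alphaEven R C x').2 p.2) :=
      fun p => alphaCl_eq_diagonal x' p.1 p.2
    rw [← hxy, map_add] at hu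
    refine ⟨x', Prod.ext (LinearMap.ext fun a => ?_) (LinearMap.ext fun a => ?_)⟩
    · have := congrArg Prod.fst (LinearMap.congr_fun hu (a, 0))
      rw [LinearMap.add_apply, Prod.fst_add, hy.1, hx, add_zero] at this
      exact this
    · have := congrArg Prod.snd (LinearMap.congr_fun hu (0, a))
      rw [LinearMap.add_apply, Prod.snd_add, hy.2, hx, add_zero] at this
      exact this

variable (R C S) in
theorem alphaEvenS_bijective : Function.Bijective (alphaEvenS (R := R) (C := C) S) := by
  have h : ∀ z, alphaEvenS (R := R) (C := C) S z =
      Prod.map (LinearMap.tensorProductEnd R S C) (LinearMap.tensorProductEnd R S C)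
        (TensorProduct.prodRight R S S _ _ ((alphaEven R C).toLinearMap.baseChange S z)) := by
    intro z
    induction z with
    | zero => simp only [map_zero, Prod.map_apply', Prod.fst_zero, Prod.snd_zero]; rfl
    | add a b ha hb =>
      rw [map_add, ha, hb, map_add, map_add, Prod.map_apply', Prod.map_apply', Prod.map_apply',
        Prod.fst_add, Prod.snd_add, map_add, map_add]
      rfl
    | tmul s u => rfl
  rw [show ⇑(alphaEvenS (R := R) (C := C) S) = _ from funext h]
  have hb := LinearMap.tensorProductEnd_bijective R S C
  exact (hb.prodMap hb).comp ((LinearEquiv.bijective _).comp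
    ((LinearEquiv.ofBijective _ (alphaEven_bijective R C)).baseChange R S _ _).bijective)

theorem alphaClS_evenS (u : S ⊗[R] CliffordAlgebra.even nq) :
    alphaClS R C S (evenS S u) = (alphaEvenS S u).1.prodMap (alphaEvenS S u).2 := by
  induction u with
  | zero => simp only [map_zero, Prod.fst_zero, Prod.snd_zero]; rfl
  | add a b ha hb =>
    rw [map_add, map_add, ha, hb, map_add]
    refine LinearMap.ext fun p => rfl
  | tmul s u =>
    refine prod_end_ext fun a b => ?_
    change alphaClS R C S (s ⊗ₜ u.1) _ =
      (algebraMap S (Module.End S (S ⊗[R] C)) s ((alphaEven R C u).1.baseChange S (1 ⊗ₜ a)),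
        algebraMap S (Module.End S (S ⊗[R] C)) s ((alphaEven R C u).2.baseChange S (1 ⊗ₜ b)))
    rw [alphaClS_tmul_apply, TensorProduct.prodRight_symm_tmul, LinearMap.baseChange_tmul,
      map_smul, TensorProduct.prodRight_tmul, alphaCl_eq_diagonal, LinearMap.baseChange_tmul,
      LinearMap.baseChange_tmul]
    rfl

end BaseChange

end OctonionAlgebra

namespace OctonionAlgebra

/-! ### Related triples of isometries -/

section Related

variable {R C : Type u} [CommRing R] [NonAssocRing C] [Module R C]
  [SMulCommClass R C C] [IsScalarTower R C C] [OctonionAlgebra R C]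

local notation "nq" => norm (R := R) (C := C)
local notation "bq" => QuadraticMap.polarBilin (norm (R := R) (C := C))

variable (R C) in
theorem norm_one : nq 1 = 1 :=
  eq_of_forall_smul_eq (C := C) fun x => by rw [norm_one_smul, one_smul]

theorem polar_map_map {t : C →ₗ[R] C} (h : ∀ x, nq (t x) = nq x) (x y : C) :
    bq (t x) (t y) = bq x y := by
  simp only [QuadraticMap.polarBilin_apply_apply, QuadraticMap.polar, ← map_add, h]

/-- Preserving b does not imply preserving q when 2 is a zero divisor. Taking norms in the relation
with x = 1 or y = 1 gives q(t₃ y) = λ q(y) with λ = q(t₃ 1). Polarizing gives λb = b, so λ = 1 by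
regularity and faithfulness. -/
theorem IsRelated.norm_map {t₁ t₂ t₃ : C →ₗ[R] C} (h : IsRelated R t₂ t₃ t₁)
    (h₁ : ∀ x, nq (t₁ x) = nq x) (h₃ : ∀ x y, bq (t₃ x) (t₃ y) = bq x y) :
    (∀ x, nq (t₂ x) = nq x) ∧ ∀ x, nq (t₃ x) = nq x := by
  have key : ∀ x y, nq (t₂ (conj R C (x * y))) = nq x * nq (t₃ y) := fun x y => by
    rw [h, norm_conj, norm_mul, h₁]
  have h2 : ∀ y, nq (t₂ (conj R C y)) = nq (t₃ y) := fun y => by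
    rw [← one_mul y, key, norm_one, one_mul, one_mul]
  have h3 : ∀ y, nq (t₃ y) = nq (t₃ 1) * nq y := fun y => by
    rw [← h2, ← mul_one y, key, mul_one, mul_comm]
  have hl : nq (t₃ 1) = 1 := by
    refine eq_of_forall_smul_eq (C := C) fun x => eq_of_polar (R := R) fun z => ?_
    rw [_root_.map_smul, LinearMap.smul_apply, one_smul]
    conv_rhs => rw [← h₃ x z]
    simp only [QuadraticMap.polarBilin_apply_apply, QuadraticMap.polar, ← map_add, h3 (x + z), h3 x,
      h3 z, smul_eq_mul]
    ring
  have h3' : ∀ y, nq (t₃ y) = nq y := fun y => by rw [h3, hl, one_mul]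
  refine ⟨fun x => ?_, h3'⟩
  conv_lhs => rw [← conj_conj (R := R) x]
  rw [h2, h3', norm_conj]

/-- The adjoint s of t for b satisfies st = 1. It is thus a surjective endomorphism of a finite
module, hence injective, and so a two-sided inverse. -/
theorem isUnit_of_norm_map {t : Module.End R C} (h : ∀ x, nq (t x) = nq x) : IsUnit t := by
  let e : C ≃ₗ[R] Module.Dual R C := LinearEquiv.ofBijective bq regular
  let s : Module.End R C := e.symm.toLinearMap ∘ₗ t.dualMap ∘ₗ e.toLinearMap
  have hs : s * t = 1 := by
    refine LinearMap.ext fun x => ?_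
    apply e.injective
    change e (e.symm (t.dualMap (e (t x)))) = e x
    rw [e.apply_symm_apply]
    exact LinearMap.ext fun y => polar_map_map h x y
  have hsurj : Function.Surjective s := fun x => ⟨t x, LinearMap.congr_fun hs x⟩
  have hinj : Function.Injective s := OrzechProperty.injective_of_surjective_endomorphism s hsurj
  have hst : ∀ x, s (t x) = x := LinearMap.congr_fun hs
  rw [Module.End.isUnit_iff]
  refine ⟨fun x y hxy => ?_, fun y => ⟨s y, hinj (hst (s y))⟩⟩
  rw [← hst x, hxy, hst]

theorem IsRelated.prodMap_mul_alpha {t₁ t₂ t₃ : LinearMap.GeneralLinearGroup R C}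
    (h : IsRelated R t₁.1 t₂.1 t₃.1) (h₁ : t₁ ∈ (nq).orthogonal)
    (h₂ : t₂ ∈ (nq).orthogonal) (h₃ : t₃ ∈ (nq).orthogonal) (x : C) :
    t₃.1.prodMap t₂.1 * alpha R C x = alpha R C (t₁.1 x) * t₃.1.prodMap t₂.1 := by
  have hr := h.rotate (polar_map_map h₁) (polar_map_map h₂) ((Module.End.isUnit_iff _).1 t₂.isUnit).2
  exact isRelated_iff_prodMap_mul_alpha.2 ⟨hr, hr.rotate (polar_map_map h₂) (polar_map_map h₃)
    ((Module.End.isUnit_iff _).1 t₃.isUnit).2⟩ x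

/-- Through α', the automorphism Cl(t₁) becomes conjugation by U = diag(t₃, t₂). This U is the image
of an even element, with which every central even z commutes. -/
theorem IsRelated.mem_specialOrthogonal {t₁ t₂ t₃ : LinearMap.GeneralLinearGroup R C}
    (h : IsRelated R t₁.1 t₂.1 t₃.1) (h₁ : t₁ ∈ (nq).orthogonal)
    (h₂ : t₂ ∈ (nq).orthogonal) (h₃ : t₃ ∈ (nq).orthogonal) : t₁ ∈ (nq).specialOrthogonal := by
  refine ⟨h₁, fun z hz => ?_⟩
  have hx := h.prodMap_mul_alpha h₁ h₂ h₃
  set U : Module.End R (C × C) := t₃.1.prodMap t₂.1 with hU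
  have hmap : ∀ w, U * alphaCl R C w =
      alphaCl R C (CliffordAlgebra.map (QuadraticForm.orthogonal.toIsometry ⟨t₁, h₁⟩) w) * U := by
    intro w
    induction w using CliffordAlgebra.induction with
    | algebraMap r => rw [AlgHom.commutes, AlgHom.commutes, AlgHom.commutes, Algebra.commutes]
    | ι x =>
      rw [CliffordAlgebra.map_apply_ι, alphaCl_ι, alphaCl_ι, hx]
      rfl
    | mul a b ha hb => rw [map_mul, map_mul, map_mul, ← mul_assoc, ha, mul_assoc, hb, mul_assoc]
    | add a b ha hb => rw [map_add, map_add, map_add, mul_add, add_mul, ha, hb]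
  obtain ⟨u, hu⟩ := (alphaEven_bijective R C).2 (t₃.1, t₂.1)
  have hu' : alphaCl R C u = U := by rw [alphaCl_even_eq_prodMap, hu]
  have hc : (u : CliffordAlgebra nq) * z = z * u := congrArg Subtype.val (Subalgebra.mem_center_iff.1 hz u)
  have hUs : Function.Surjective U :=
    Function.Surjective.prodMap ((Module.End.isUnit_iff _).1 t₃.isUnit).2
      ((Module.End.isUnit_iff _).1 t₂.isUnit).2
  apply (alphaCl_bijective R C).1
  refine LinearMap.ext fun p => ?_
  obtain ⟨p, rfl⟩ := hUs p
  change (alphaCl R C _ * U) p = (alphaCl R C z * U) p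
  rw [← hmap, ← hu', ← map_mul, ← map_mul, hc]

theorem polar_alpha_left (x : C) (p p' : C × C) :
    bq (alpha R C x p).1 p'.1 + bq (alpha R C x p).2 p'.2 =
      bq p.1 (alpha R C x p').1 + bq p.2 (alpha R C x p').2 := by
  have h1 : ∀ a b : C, bq (conj R C x * conj R C a) b = bq a (conj R C (x * b)) :=
    fun a b => (polar_conj_mul (R := R) _ _ _).trans (polar_conj_left (R := R) _ _)
  have h2 : ∀ a b : C, bq a b = bq b a := polar_comm
  rw [alpha_apply, alpha_apply]
  dsimp only
  rw [h1, h2 p.1, h1, h2 p'.2, add_comm]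

end Related

/-! ### The isomorphism between `RT'(C)` and `Spin(q_C)` -/

section Spin

variable {R C : Type u} [CommRing R] [NonAssocRing C] [Module R C]
  [SMulCommClass R C C] [IsScalarTower R C C] [OctonionAlgebra R C]
variable {S : Type u} [CommRing S] [Algebra R S]

local notation "nq" => norm (R := R) (C := C)
local notation "bS" => QuadraticMap.polarBilin (normS (R := R) (C := C) S)

attribute [local instance] baseChange

theorem mem_RT'_iff {t : GLPoints R C S × GLPoints R C S × GLPoints R C S} :
    t ∈ RT' R C S ↔ (t.1 ∈ (normS (R := R) (C := C) S).orthogonal ∧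
      t.2.1 ∈ (normS (R := R) (C := C) S).orthogonal ∧
      t.2.2 ∈ (normS (R := R) (C := C) S).orthogonal) ∧ IsRelated S t.1.1 t.2.1.1 t.2.2.1 := by
  refine and_congr_right fun _ => ⟨fun h x y => ?_, fun h x y => ?_⟩
  · have := h (conjS (R := R) S y) (conjS (R := R) S x)
    rw [conjS_conjS, conjS_conjS] at this
    rw [conj_mul, conj_mul, conj_baseChange, conj_baseChange, conj_baseChange, conj_baseChange, this]
  · have := h (conjS (R := R) S y) (conjS (R := R) S x)
    rw [conj_mul, conj_mul, conj_baseChange, conj_baseChange, conj_baseChange, conj_baseChange,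
      conjS_conjS, conjS_conjS] at this
    exact this

/-- Rotation brings each component in turn into the first position. -/
theorem RT'_eq_RT : RT' R C S = RT R C S := by
  refine (inf_eq_left.2 fun t ht => ?_).symm
  obtain ⟨⟨h1, h2, h3⟩, h⟩ := mem_RT'_iff.1 ht
  have hr := h.rotate (polar_map_map h1) (polar_map_map h2)
    ((Module.End.isUnit_iff _).1 t.2.1.isUnit).2
  have hr' := hr.rotate (polar_map_map h2) (polar_map_map h3)
    ((Module.End.isUnit_iff _).1 t.2.2.isUnit).2
  exact ⟨h.mem_specialOrthogonal h1 h2 h3, hr.mem_specialOrthogonal h2 h3 h1,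
    hr'.mem_specialOrthogonal h3 h1 h2⟩

/-- α' carries σ to the adjoint for b ⊥ b: both reverse products, and each α(x) is self-adjoint. -/
theorem polar_alphaClS_sigmaS (z : S ⊗[R] CliffordAlgebra nq) :
    ∀ p p' : (S ⊗[R] C) × (S ⊗[R] C),
      bS (alphaClS R C S (sigmaS S z) p).1 p'.1 + bS (alphaClS R C S (sigmaS S z) p).2 p'.2 =
        bS p.1 (alphaClS R C S z p').1 + bS p.2 (alphaClS R C S z p').2 := by
  let N : Submodule S (S ⊗[R] CliffordAlgebra nq) :=
    { carrier := {z | ∀ p p' : (S ⊗[R] C) × (S ⊗[R] C),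
        bS (alphaClS R C S (sigmaS S z) p).1 p'.1 + bS (alphaClS R C S (sigmaS S z) p).2 p'.2 =
          bS p.1 (alphaClS R C S z p').1 + bS p.2 (alphaClS R C S z p').2}
      zero_mem' := fun p p' => by
        simp only [map_zero, LinearMap.zero_apply, Prod.fst_zero, Prod.snd_zero]
      add_mem' := fun {a b} ha hb p p' => by
        simp only [map_add, LinearMap.add_apply, Prod.fst_add, Prod.snd_add]
        linear_combination ha p p' + hb p p'
      smul_mem' := fun s a ha p p' => by
        simp only [map_smul, LinearMap.smul_apply, Prod.smul_fst, Prod.smul_snd, smul_eq_mul]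
        linear_combination s * ha p p' }
  have hN : N = ⊤ := by
    refine submodule_tensor_clifford_eq_top S N (fun p p' => ?_) fun v x hx p p' => ?_
    · rw [sigmaS_one, map_one]
      rfl
    · have hv : sigmaS S (iotaS (R := R) (C := C) S v) = iotaS S v := by
        rw [sigmaS, iotaS, ← LinearMap.comp_apply, ← LinearMap.baseChange_comp]
        congr 1
        congr 1
        exact LinearMap.ext fun x => CliffordAlgebra.reverse_ι x
      rw [sigmaS_mul, map_mul, map_mul, hv, Module.End.mul_apply, Module.End.mul_apply,
        alphaClS_iotaS]
      exact (hx _ _).trans (polar_alpha_left v p _)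
  exact (hN ▸ Submodule.mem_top : z ∈ N)

theorem evenS_mul_iotaS {t : GLPoints R C S × GLPoints R C S × GLPoints R C S}
    (ht : t ∈ RT' R C S) {u : S ⊗[R] CliffordAlgebra.even nq}
    (hu : alphaEvenS S u = (t.2.2.1, t.2.1.1)) (x : S ⊗[R] C) :
    evenS S u * iotaS S x = iotaS S (t.1.1 x) * evenS S u := by
  obtain ⟨⟨h1, h2, h3⟩, h⟩ := mem_RT'_iff.1 ht
  apply (alphaClS_bijective R C S).1
  rw [map_mul, map_mul, alphaClS_iotaS, alphaClS_iotaS, alphaClS_evenS, hu]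
  exact h.prodMap_mul_alpha h1 h2 h3 x

/-- Because σ(u) acts as the adjoint of u, the equation σ(u)u = 1 says that u preserves b ⊥ b, that
is, block by block. Invertibility of u allows the order of the factors to be exchanged. -/
theorem evenS_mul_sigmaS_eq_one_iff (u : (S ⊗[R] CliffordAlgebra.even nq)ˣ) :
    evenS S u.1 * sigmaS S (evenS S u.1) = 1 ↔
      (∀ x y, bS ((alphaEvenS S u.1).1 x) ((alphaEvenS S u.1).1 y) = bS x y) ∧
        ∀ x y, bS ((alphaEvenS S u.1).2 x) ((alphaEvenS S u.1).2 y) = bS x y := by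
  have hadj := polar_alphaClS_sigmaS (evenS S u.1)
  have hu : IsUnit (evenS S u.1) := u.isUnit.map _
  have hcomm : evenS S u.1 * sigmaS S (evenS S u.1) = 1 ↔
      sigmaS S (evenS S u.1) * evenS S u.1 = 1 :=
    ⟨fun h => (left_inv_eq_right_inv (hu.unit.inv_mul) h) ▸ hu.unit.inv_mul,
      fun h => (left_inv_eq_right_inv h (hu.unit.mul_inv)) ▸ hu.unit.mul_inv⟩
  rw [hcomm]
  constructor
  · intro h
    have h' : ∀ p p' : (S ⊗[R] C) × (S ⊗[R] C),
        bS p.1 p'.1 + bS p.2 p'.2 = bS (alphaClS R C S (evenS S u.1) p).1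
          (alphaClS R C S (evenS S u.1) p').1 + bS (alphaClS R C S (evenS S u.1) p).2
          (alphaClS R C S (evenS S u.1) p').2 := by
      intro p p'
      rw [← hadj, ← Module.End.mul_apply, ← map_mul, h, map_one, Module.End.one_apply]
    rw [alphaClS_evenS] at h'
    refine ⟨fun x y => ?_, fun x y => ?_⟩
    · simpa using (h' (x, 0) (y, 0)).symm
    · simpa using (h' (0, x) (0, y)).symm
  · rintro ⟨h1, h2⟩
    apply (alphaClS_bijective R C S).1
    refine LinearMap.ext fun p => ?_
    have h' : ∀ p' : (S ⊗[R] C) × (S ⊗[R] C),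
        bS (alphaClS R C S (sigmaS S (evenS S u.1) * evenS S u.1) p).1 p'.1 +
          bS (alphaClS R C S (sigmaS S (evenS S u.1) * evenS S u.1) p).2 p'.2 =
        bS p.1 p'.1 + bS p.2 p'.2 := by
      intro p'
      rw [map_mul, Module.End.mul_apply, hadj, alphaClS_evenS]
      exact congrArg₂ _ (h1 _ _) (h2 _ _)
    rw [map_one, Module.End.one_apply]
    refine Prod.ext (eq_of_polar (R := S) fun z => ?_) (eq_of_polar (R := S) fun z => ?_)
    · have := h' (z, 0)
      simp only [map_zero, add_zero] at this
      exact this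
    · have := h' (0, z)
      simp only [map_zero, zero_add] at this
      exact this

theorem mem_vectors_of_evenS_mul {u : (S ⊗[R] CliffordAlgebra.even nq)ˣ} {t : Module.End S (S ⊗[R] C)}
    (h : ∀ x, evenS S u.1 * iotaS S x = iotaS S (t x) * evenS S u.1) (x : S ⊗[R] C) :
    evenS S u.1 * iotaS S x * evenS S u⁻¹.1 = iotaS S (t x) := by
  rw [h, mul_assoc, ← map_mul, u.mul_inv, map_one, mul_one]

variable (R C S) in
/-- The isomorphism `(End_S(C_S) × End_S(C_S))^* ≃ Cl₀(C, q)_S^*` inverse to `α''_S`. -/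
noncomputable def evenUnitsEquiv : (S ⊗[R] CliffordAlgebra.even nq)ˣ ≃*
    (Module.End S (S ⊗[R] C) × Module.End S (S ⊗[R] C))ˣ :=
  Units.mapEquiv (AlgEquiv.ofBijective _ (alphaEvenS_bijective R C S) : _ ≃* _)

variable (R C S) in
/-- The homomorphism `(t₁, t₂, t₃) ↦ α''_S⁻¹(t₃, t₂)`. -/
noncomputable def tripleToEven : GLPoints R C S × GLPoints R C S × GLPoints R C S →*
    (S ⊗[R] CliffordAlgebra.even nq)ˣ :=
  (evenUnitsEquiv R C S).symm.toMonoidHom.comp (MulEquiv.prodUnits.symm.toMonoidHom.comp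
    (MonoidHom.prod ((MonoidHom.snd _ _).comp (MonoidHom.snd _ _))
      ((MonoidHom.fst _ _).comp (MonoidHom.snd _ _))))

theorem alphaEvenS_tripleToEven (t : GLPoints R C S × GLPoints R C S × GLPoints R C S) :
    alphaEvenS S (tripleToEven R C S t).1 = (t.2.2.1, t.2.1.1) :=
  congrArg Units.val ((evenUnitsEquiv R C S).apply_symm_apply
    (MulEquiv.prodUnits.symm (t.2.2, t.2.1)))

theorem tripleToEven_mem_Spin {t : GLPoints R C S × GLPoints R C S × GLPoints R C S}
    (ht : t ∈ RT' R C S) : tripleToEven R C S t ∈ Spin R C S := by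
  have hv : ∀ {t}, t ∈ RT' R C S → ∀ x, evenS S (tripleToEven R C S t).1 * iotaS S x *
      evenS S (tripleToEven R C S t)⁻¹.1 = iotaS S (t.1.1 x) := fun ht =>
    mem_vectors_of_evenS_mul (evenS_mul_iotaS ht (alphaEvenS_tripleToEven _))
  refine ⟨?_, ?_⟩
  · rw [conj_image_eq_iff]
    refine ⟨?_, ?_⟩
    · rintro _ ⟨x, rfl⟩
      exact ⟨_, (hv ht x).symm⟩
    · rintro _ ⟨x, rfl⟩
      -- The reverse inclusion is the forward one for t⁻¹, whose image is u⁻¹.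
      have := hv (inv_mem ht) x
      rw [map_inv, inv_inv] at this
      exact ⟨_, this.symm⟩
  · rw [evenS_mul_sigmaS_eq_one_iff, alphaEvenS_tripleToEven]
    exact ⟨polar_map_map (R := S) ht.1.2.2, polar_map_map (R := S) ht.1.2.1⟩

/-- x is recovered from α(x)(1, 0) = (0, x̄). -/
theorem iotaS_injective : Function.Injective (iotaS (R := R) (C := C) S) := by
  rw [injective_iff_map_eq_zero]
  intro x hx
  have h := alphaClS_iotaS x
  rw [hx, map_zero] at h
  have h1 : conj S (S ⊗[R] C) (x * 1) = 0 := (congrArg Prod.snd (LinearMap.congr_fun h (1, 0))).symm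
  rw [mul_one] at h1
  rw [← conj_conj (R := S) x, h1, map_zero]

theorem exists_linearMap_conj {u : (S ⊗[R] CliffordAlgebra.even nq)ˣ} (hu : u ∈ Spin R C S) :
    ∃ t : Module.End S (S ⊗[R] C),
      ∀ x, iotaS S (t x) = evenS S u.1 * iotaS S x * evenS S u⁻¹.1 := by
  have h := ((conj_image_eq_iff u).1 hu.1).1
  choose f hf using fun x => h _ ⟨x, rfl⟩
  refine ⟨{ toFun := f, map_add' := fun x y => ?_, map_smul' := fun s x => ?_ }, hf⟩
  · apply iotaS_injective
    rw [hf, map_add, map_add, hf, hf, mul_add, add_mul]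
  · apply iotaS_injective
    rw [hf, map_smul, map_smul, hf, mul_smul_comm, smul_mul_assoc]
    rfl

/-- In the Clifford algebra y² = u x² u⁻¹ = x², an equality of scalars. It descends to S because C_S
is faithful. -/
theorem normS_eq_of_conj {u : (S ⊗[R] CliffordAlgebra.even nq)ˣ} {x y : S ⊗[R] C}
    (h : iotaS S y = evenS S u.1 * iotaS S x * evenS S u⁻¹.1) :
    normS (R := R) S y = normS (R := R) S x := by
  have h1 : algebraMap S (S ⊗[R] CliffordAlgebra nq) (normS (R := R) S y) =
      algebraMap S _ (normS (R := R) S x) := by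
    have h2 : evenS S u⁻¹.1 * evenS S u.1 = 1 := by rw [← map_mul, u.inv_mul, map_one]
    have h3 : evenS S u.1 * evenS S u⁻¹.1 = 1 := by rw [← map_mul, u.mul_inv, map_one]
    calc _ = iotaS S y * iotaS S y := (iotaS_mul_self S y).symm
      _ = evenS S u.1 * iotaS S x * (evenS S u⁻¹.1 * evenS S u.1) * iotaS S x * evenS S u⁻¹.1 := by
        rw [h]
        noncomm_ring
      _ = evenS S u.1 * (iotaS S x * iotaS S x) * evenS S u⁻¹.1 := by
        rw [h2]
        noncomm_ring
      _ = _ := by rw [iotaS_mul_self, ← Algebra.commutes, mul_assoc, h3, mul_one]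
  have h2 := congrArg (alphaClS R C S) h1
  rw [AlgHom.commutes, AlgHom.commutes] at h2
  exact eq_of_forall_smul_eq (C := S ⊗[R] C) fun z =>
    congrArg Prod.fst (LinearMap.congr_fun h2 (z, 0))

/-- t₁ is conjugation by u, and (t₃, t₂) is α''(u). Intertwining yields two rotations of the
relation, hence the relation itself. The condition u σ(u) = 1 gives invariance of b under t₂ and t₃,
which `IsRelated.norm_map` upgrades to invariance of q. -/
theorem exists_tripleToEven_eq {u : (S ⊗[R] CliffordAlgebra.even nq)ˣ} (hu : u ∈ Spin R C S) :
    ∃ t ∈ RT' R C S, tripleToEven R C S t = u := by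
  obtain ⟨f, hf⟩ := exists_linearMap_conj hu
  have hfn : ∀ x, normS (R := R) S (f x) = normS (R := R) S x := fun x => normS_eq_of_conj (hf x)
  obtain ⟨t₁, rfl⟩ := isUnit_of_norm_map (R := S) hfn
  obtain ⟨⟨t₃, t₂⟩, ht⟩ := MulEquiv.prodUnits.symm.surjective (evenUnitsEquiv R C S u)
  have hα : alphaEvenS S u.1 = (t₃.1, t₂.1) := (congrArg Units.val ht).symm
  have hcomm : ∀ x, evenS S u.1 * iotaS S x = iotaS S (t₁.1 x) * evenS S u.1 := fun x => by
    rw [hf, mul_assoc _ (evenS S u⁻¹.1), ← map_mul, u.inv_mul, map_one, mul_one]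
  have hrel : IsRelated S t₂.1 t₃.1 t₁.1 ∧ IsRelated S t₃.1 t₁.1 t₂.1 := by
    refine isRelated_iff_prodMap_mul_alpha.1 fun x => ?_
    have := congrArg (alphaClS R C S) (hcomm x)
    rwa [map_mul, map_mul, alphaClS_iotaS, alphaClS_iotaS, alphaClS_evenS, hα] at this
  obtain ⟨hb3, hb2⟩ := (evenS_mul_sigmaS_eq_one_iff u).1 hu.2
  rw [hα] at hb3 hb2
  obtain ⟨hn2, hn3⟩ := hrel.1.norm_map hfn hb3
  have h := hrel.2.rotate hb3 (polar_map_map (R := S) hfn)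
    ((Module.End.isUnit_iff _).1 t₁.isUnit).2
  refine ⟨(t₁, t₂, t₃), mem_RT'_iff.2 ⟨⟨hfn, hn2, hn3⟩, h⟩, Units.ext ?_⟩
  apply (alphaEvenS_bijective R C S).1
  rw [alphaEvenS_tripleToEven, hα]

variable (R C S) in
/-- The homomorphism `RT'(C)(S) → Spin(q_C)(S)`, `(t₁, t₂, t₃) ↦ α''_S⁻¹(t₃, t₂)`. -/
noncomputable def rtToSpin : RT' R C S →* Spin R C S :=
  ((tripleToEven R C S).comp (RT' R C S).subtype).codRestrict _ fun t => tripleToEven_mem_Spin t.2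

theorem alphaEvenS_rtToSpin (t : RT' R C S) :
    alphaEvenS S (rtToSpin R C S t).1.1 = (t.1.2.2.1, t.1.2.1.1) :=
  alphaEvenS_tripleToEven t.1

theorem rtToSpin_conj (t : RT' R C S) (x : S ⊗[R] C) : iotaS S (t.1.1.1 x) =
    evenS S (rtToSpin R C S t).1.1 * iotaS S x * evenS S (rtToSpin R C S t).1⁻¹.1 :=
  (mem_vectors_of_evenS_mul (evenS_mul_iotaS t.2 (alphaEvenS_tripleToEven _)) x).symm

variable (R C S) in
theorem rtToSpin_bijective : Function.Bijective (rtToSpin R C S) := by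
  refine ⟨fun t t' h => ?_, fun u => ?_⟩
  · have h23 := alphaEvenS_rtToSpin t
    rw [h, alphaEvenS_rtToSpin, Prod.mk.injEq] at h23
    refine Subtype.ext (Prod.ext (Units.ext (LinearMap.ext fun x => iotaS_injective ?_))
      (Prod.ext (Units.ext h23.2.symm) (Units.ext h23.1.symm)))
    rw [rtToSpin_conj, rtToSpin_conj, h]
  · obtain ⟨t, ht, h⟩ := exists_tripleToEven_eq u.2
    exact ⟨⟨t, ht⟩, Subtype.ext h⟩

theorem alphaEvenS_evenMap {T : Type u} [CommRing T] [Algebra R T] (f : S →ₐ[R] T)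
    (u : S ⊗[R] CliffordAlgebra.even nq) :
    alphaEvenS T (evenMap f u) = (ScalarChange.endMap C f (alphaEvenS S u).1,
      ScalarChange.endMap C f (alphaEvenS S u).2) := by
  have key : ∀ (s : S) (φ : Module.End R C), ScalarChange.endMap C f (s • φ.baseChange S) =
      f s • φ.baseChange T := fun s φ => ScalarChange.end_ext fun x => by
    rw [ScalarChange.endMap_one_tmul]
    simp [smul_tmul']
  have hadd : ∀ φ ψ : Module.End S (S ⊗[R] C), ScalarChange.endMap C f (φ + ψ) =
      ScalarChange.endMap C f φ + ScalarChange.endMap C f ψ := fun φ ψ =>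
    ScalarChange.end_ext fun x => by
      simp only [ScalarChange.endMap_one_tmul, LinearMap.add_apply, map_add]
  induction u with
  | zero =>
    have h0 : ScalarChange.endMap C f (0 : Module.End S (S ⊗[R] C)) = 0 :=
      ScalarChange.end_ext fun x => by simp [ScalarChange.endMap_one_tmul]
    simp only [map_zero, Prod.fst_zero, Prod.snd_zero, h0]
    rfl
  | add a b ha hb => rw [map_add, map_add, ha, hb, map_add, Prod.fst_add, Prod.snd_add, hadd, hadd]; rfl
  | tmul s u =>
    refine Prod.ext ?_ ?_
    · exact (key s (alphaEven R C u).1).symm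
    · exact (key s (alphaEven R C u).2).symm

theorem rtToSpin_rtMap {T : Type u} [CommRing T] [Algebra R T] (f : S →ₐ[R] T) (t : RT' R C S) :
    rtToSpin R C T (rtMap f t) = spinMap f (rtToSpin R C S t) := by
  refine Subtype.ext (Units.ext ((alphaEvenS_bijective R C T).1 ?_))
  rw [alphaEvenS_rtToSpin]
  change _ = alphaEvenS T (evenMap f (rtToSpin R C S t).1.1)
  rw [alphaEvenS_evenMap, alphaEvenS_rtToSpin]
  rfl

end Spin

end OctonionAlgebra

/-! ### Representability -/

/-- A functor on `R`-rings that is a naturally embedded subfunctor of an affine space, cut out by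
natural equations, is represented by an `R`-ring. -/
theorem isCorepresentable_of_zeroLocus {R : Type u} [CommRing R] (F : CommAlgCat.{u} R ⥤ Type u)
    {ι : Type} {J : Type*} (c : ∀ S : CommAlgCat.{u} R, F.obj S → ι → S)
    (hc : ∀ {S T : CommAlgCat.{u} R} (f : S ⟶ T) (x : F.obj S) (i : ι),
      c T (F.map f x) i = f.hom (c S x i))
    (hinj : ∀ S, Function.Injective (c S))
    (E : J → ∀ S : CommAlgCat.{u} R, (ι → S) → S)
    (hE : ∀ (j : J) {S T : CommAlgCat.{u} R} (f : S ⟶ T) (a : ι → S),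
      E j T (fun i => f.hom (a i)) = f.hom (E j S a))
    (hrange : ∀ (S : CommAlgCat.{u} R) (a : ι → S), (∀ j, E j S a = 0) ↔ ∃ x, c S x = a) : F.IsCorepresentable := by
  let A : CommAlgCat.{u} R := CommAlgCat.of R (MvPolynomial ι R)
  let I : Ideal (MvPolynomial ι R) := Ideal.span (Set.range fun j => E j A MvPolynomial.X)
  let B : CommAlgCat.{u} R := CommAlgCat.of R (MvPolynomial ι R ⧸ I)
  let π : A ⟶ B := CommAlgCat.ofHom (Ideal.Quotient.mkₐ R I)
  -- The universal point, whose coordinates are the classes of the variables.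
  obtain ⟨ξ, hξ⟩ := (hrange B fun i => π.hom (MvPolynomial.X i)).1 fun j => by
    rw [hE j π]
    exact Ideal.Quotient.eq_zero_iff_mem.2 (Ideal.subset_span ⟨j, rfl⟩)
  have hcξ : ∀ {S : CommAlgCat.{u} R} (f : B ⟶ S) (i : ι),
      c S (F.map f ξ) i = f.hom (Ideal.Quotient.mkₐ R I (MvPolynomial.X i)) := fun f i => by
    rw [hc, hξ]
    rfl
  refine ⟨B, ⟨⟨fun {S} => Equiv.ofBijective (fun f => F.map f ξ) ⟨fun f g hfg => ?_, fun x => ?_⟩,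
    fun {S T} g f => ?_⟩⟩⟩
  · apply CommAlgCat.hom_ext
    apply Ideal.Quotient.algHom_ext
    apply MvPolynomial.algHom_ext
    intro i
    change f.hom (Ideal.Quotient.mkₐ R I (MvPolynomial.X i)) =
      g.hom (Ideal.Quotient.mkₐ R I (MvPolynomial.X i))
    rw [← hcξ, ← hcξ]
    exact congrArg (fun y => c S y i) hfg
  · let g : A ⟶ S := CommAlgCat.ofHom (MvPolynomial.aeval (c S x))
    have hg : ∀ i, g.hom (MvPolynomial.X i) = c S x i := fun i => MvPolynomial.aeval_X _ i
    have hI : ∀ a ∈ I, g.hom a = 0 := by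
      intro a ha
      have : I ≤ RingHom.ker g.hom := by
        refine Ideal.span_le.2 ?_
        rintro _ ⟨j, rfl⟩
        change g.hom (E j A MvPolynomial.X) = 0
        rw [← hE j g]
        simp only [hg]
        exact (hrange S _).2 ⟨x, rfl⟩ j
      exact this ha
    refine ⟨CommAlgCat.ofHom (Ideal.Quotient.liftₐ I g.hom hI), hinj S (funext fun i => ?_)⟩
    rw [hcξ]
    exact hg i
  · change F.map (f ≫ g) ξ = F.map g (F.map f ξ)
    rw [F.map_comp]
    rfl

/-! ### Matrix coordinates relative to a dual basis -/

namespace ScalarChange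

section Coordinates

variable {R : Type u} [CommRing R] {M : Type u} [AddCommGroup M] [Module R M]
variable {n : ℕ} (c : Fin n → M) (g : Fin n → Module.Dual R M)
variable {S T : Type u} [CommRing S] [Algebra R S] [CommRing T] [Algebra R T]

variable (S) in
/-- The scalar extension of a linear form. -/
noncomputable def dualExt (φ : Module.Dual R M) : Module.Dual S (S ⊗[R] M) :=
  LinearMap.liftBaseChange S (Algebra.linearMap R S ∘ₗ φ)

theorem dualExt_tmul (φ : Module.Dual R M) (s : S) (x : M) :
    dualExt S φ (s ⊗ₜ x) = s * algebraMap R S (φ x) := by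
  simp [dualExt]

theorem dualExt_map (φ : Module.Dual R M) (f : S →ₐ[R] T) (z : S ⊗[R] M) :
    dualExt T φ (map M f z) = f (dualExt S φ z) := by
  induction z with
  | zero => simp only [map_zero]
  | add a b ha hb => simp only [map_add, ha, hb]
  | tmul s x => rw [map_tmul, dualExt_tmul, dualExt_tmul, _root_.map_mul, f.commutes]

variable {c g} in
theorem sum_dualExt_smul (h : ∀ x, ∑ i, g i x • c i = x) (z : S ⊗[R] M) :
    ∑ i, dualExt S (g i) z • ((1 : S) ⊗ₜ[R] c i) = z := by
  induction z with
  | zero => simp only [map_zero, zero_smul, Finset.sum_const_zero]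
  | add a b ha hb =>
    simp only [map_add, add_smul, Finset.sum_add_distrib]
    rw [ha, hb]
  | tmul s x =>
    conv_rhs => rw [← h x, tmul_sum]
    refine Finset.sum_congr rfl fun i _ => ?_
    rw [dualExt_tmul, smul_tmul', smul_eq_mul, mul_one, tmul_smul, smul_tmul', Algebra.smul_def,
      mul_comm]

theorem eq_of_dualExt {c : Fin n → M} {g : Fin n → Module.Dual R M}
    (h : ∀ x, ∑ i, g i x • c i = x) {z w : S ⊗[R] M}
    (hzw : ∀ i, dualExt S (g i) z = dualExt S (g i) w) : z = w := by
  rw [← sum_dualExt_smul h z, ← sum_dualExt_smul h w]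
  simp only [hzw]

/-- The matrix entries of an operator. -/
noncomputable def coord (t : Module.End S (S ⊗[R] M)) (p : Fin n × Fin n) : S :=
  dualExt S (g p.1) (t (1 ⊗ₜ c p.2))

/-- The operator with given matrix entries. -/
noncomputable def ofCoord (m : Fin n × Fin n → S) : Module.End S (S ⊗[R] M) :=
  ∑ p : Fin n × Fin n, (dualExt S (g p.2)).smulRight (m p • ((1 : S) ⊗ₜ[R] c p.1))

theorem ofCoord_apply (m : Fin n × Fin n → S) (z : S ⊗[R] M) :
    ofCoord c g m z = ∑ p : Fin n × Fin n,
      dualExt S (g p.2) z • m p • ((1 : S) ⊗ₜ[R] c p.1) := by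
  simp [ofCoord]

variable {c g} in
-- Only this composite is the identity in general, since the c_i need not be linearly independent.
-- The matrices that occur are those fixed by the other composite, whence the first family in
-- `rtEquation`.
theorem ofCoord_coord (h : ∀ x, ∑ i, g i x • c i = x) (t : Module.End S (S ⊗[R] M)) :
    ofCoord c g (coord c g t) = t := by
  refine LinearMap.ext fun z => ?_
  rw [ofCoord_apply, Fintype.sum_prod_type_right]
  conv_rhs => rw [← sum_dualExt_smul h z, map_sum]
  refine Finset.sum_congr rfl fun k _ => ?_
  dsimp only
  rw [← Finset.smul_sum, LinearMap.map_smul]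
  exact congrArg (dualExt S (g k) z • ·) (sum_dualExt_smul h (t (1 ⊗ₜ c k)))

theorem coord_endMap (f : S →ₐ[R] T) (t : Module.End S (S ⊗[R] M)) (p : Fin n × Fin n) :
    coord c g (endMap M f t) p = f (coord c g t p) := by
  rw [coord, endMap_one_tmul, dualExt_map, coord]

theorem ofCoord_map (f : S →ₐ[R] T) (m : Fin n × Fin n → S) (z : S ⊗[R] M) :
    ofCoord c g (fun p => f (m p)) (map M f z) = map M f (ofCoord c g m z) := by
  rw [ofCoord_apply, ofCoord_apply, map_sum]
  refine Finset.sum_congr rfl fun p _ => ?_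
  rw [map_smul, map_smul, dualExt_map, map_tmul, map_one]

end Coordinates

end ScalarChange

/-! ### Equations for RT'(C) and the isomorphism of functors -/

namespace OctonionAlgebra

variable {R C : Type u} [CommRing R] [NonAssocRing C] [Module R C]
  [SMulCommClass R C C] [IsScalarTower R C C] [OctonionAlgebra R C]

attribute [local instance] baseChange

section Equations

variable {n : ℕ} (c : Fin n → C) (g : Fin n → Module.Dual R C)

open ScalarChange

/-- The equations of `RT'(C)` in the matrix entries of the three operators: the operators have the
given matrix entries, are isometries, and are related. -/
noncomputable def rtEquation :
    (Fin 3 × Fin n × Fin n) ⊕ (Fin 3 × C) ⊕ (Fin n × C × C) →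
      ∀ S : CommAlgCat.{u} R, (Fin 3 × Fin n × Fin n → S) → S
  | .inl (i, p), _, a =>
    coord c g (ofCoord c g fun p => a (i, p)) p - a (i, p)
  | .inr (.inl (i, x)), S, a =>
    normS (R := R) S (ofCoord c g (fun p => a (i, p)) (1 ⊗ₜ x)) - normS (R := R) S (1 ⊗ₜ[R] x)
  | .inr (.inr (j, x, y)), S, a =>
    dualExt S (g j) (ofCoord c g (fun p => a (0, p)) (1 ⊗ₜ (x * y))) -
      dualExt S (g j) (conjS (R := R) S (ofCoord c g (fun p => a (1, p)) (1 ⊗ₜ conj R C x)) *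
        conjS (R := R) S (ofCoord c g (fun p => a (2, p)) (1 ⊗ₜ conj R C y)))

theorem rtEquation_natural (j : (Fin 3 × Fin n × Fin n) ⊕ (Fin 3 × C) ⊕ (Fin n × C × C))
    {S T : CommAlgCat.{u} R} (f : S ⟶ T) (a : Fin 3 × Fin n × Fin n → S) :
    rtEquation c g j T (fun i => f.hom (a i)) = f.hom (rtEquation c g j S a) := by
  have h1 : ∀ (i : Fin 3) (x : C), ofCoord c g (fun p => f.hom (a (i, p))) ((1 : T) ⊗ₜ[R] x) =
      map C f.hom (ofCoord c g (fun p => a (i, p)) (1 ⊗ₜ x)) := fun i x => by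
    rw [← ofCoord_map, ScalarChange.map_tmul, _root_.map_one]
  rcases j with ⟨i, p⟩ | ⟨i, x⟩ | ⟨j, x, y⟩
  · simp only [rtEquation, coord]
    rw [h1, dualExt_map, map_sub]
  · simp only [rtEquation]
    rw [h1, scalarExtension_map, normS_one_tmul, normS_one_tmul, map_sub, AlgHom.commutes]
  · simp only [rtEquation]
    rw [h1, h1, h1, conjS_map, conjS_map, ← ScalarChange.map_mul, dualExt_map, dualExt_map, map_sub]

variable {c g}

/-- Testing on elements 1 ⊗ x suffices, as these determine quadratic forms and bilinear maps on C_S.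
Invertibility needs no equation: isometries of a regular form on a finite module are invertible. -/
theorem rtEquation_eq_zero_iff (h : ∀ x, ∑ i, g i x • c i = x) (S : CommAlgCat.{u} R)
    (a : Fin 3 × Fin n × Fin n → S) :
    (∀ j, rtEquation c g j S a = 0) ↔ ∃ t : RT' R C S,
      (fun i : Fin 3 × Fin n × Fin n =>
        coord c g (![t.1.1.1, t.1.2.1.1, t.1.2.2.1] i.1) i.2) = a := by
  constructor
  · intro ha
    have hco : ∀ i p, coord c g (ofCoord c g fun p => a (i, p)) p = a (i, p) := fun i p =>
      sub_eq_zero.1 (ha (.inl (i, p)))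
    have hn : ∀ i z, normS (R := R) S (ofCoord c g (fun p => a (i, p)) z) = normS (R := R) S z := by
      intro i
      have : (normS (R := R) (C := C) S).comp (ofCoord c g fun p => a (i, p)) =
          normS (R := R) (C := C) S :=
        baseChange_ext fun x : C => sub_eq_zero.1 (ha (.inr (.inl (i, x))))
      exact fun z => congrArg (fun Q => Q z) this
    choose t ht using fun i => isUnit_of_norm_map (R := S) (hn i)
    have h3 : ∀ x y : C, (t 0).1 ((1 ⊗ₜ x) * (1 ⊗ₜ y)) =
        conjS (R := R) S ((t 1).1 (conjS (R := R) S (1 ⊗ₜ x))) *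
          conjS (R := R) S ((t 2).1 (conjS (R := R) S (1 ⊗ₜ y))) := by
      intro x y
      refine eq_of_dualExt h fun j => ?_
      have := sub_eq_zero.1 (ha (.inr (.inr (j, x, y))))
      rw [ht, ht, ht, Algebra.TensorProduct.tmul_mul_tmul, mul_one]
      exact this
    have h4 : ∀ x y : S ⊗[R] C, (t 0).1 (x * y) =
        conjS (R := R) S ((t 1).1 (conjS (R := R) S x)) *
          conjS (R := R) S ((t 2).1 (conjS (R := R) S y)) := by
      intro x y
      have e1 : ∀ y : C, (t 0).1 ∘ₗ LinearMap.mulRight S ((1 : S) ⊗ₜ[R] y) =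
          LinearMap.mulRight S (conjS (R := R) S ((t 2).1 (conjS (R := R) S (1 ⊗ₜ y)))) ∘ₗ
            conjS (R := R) S ∘ₗ (t 1).1 ∘ₗ conjS (R := R) S := fun y =>
        linearMap_ext_one_tmul fun x => h3 x y
      have e2 : (t 0).1 ∘ₗ LinearMap.mulLeft S x =
          LinearMap.mulLeft S (conjS (R := R) S ((t 1).1 (conjS (R := R) S x))) ∘ₗ
            conjS (R := R) S ∘ₗ (t 2).1 ∘ₗ conjS (R := R) S :=
        linearMap_ext_one_tmul fun y => LinearMap.congr_fun (e1 y) x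
      exact LinearMap.congr_fun e2 y
    have ho : ∀ i, t i ∈ (normS (R := R) (C := C) S).orthogonal := fun i z => by
      rw [ht]
      exact hn i z
    refine ⟨⟨(t 0, t 1, t 2), ⟨ho 0, ho 1, ho 2⟩, h4⟩, funext fun ⟨i, p⟩ => ?_⟩
    rw [← hco i p, ← ht]
    fin_cases i <;> rfl
  · rintro ⟨t, rfl⟩ j
    have e0 := ofCoord_coord h t.1.1.1
    have e1 := ofCoord_coord h t.1.2.1.1
    have e2 := ofCoord_coord h t.1.2.2.1
    have e : ∀ i, ofCoord c g (coord c g (![t.1.1.1, t.1.2.1.1, t.1.2.2.1] i)) =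
        ![t.1.1.1, t.1.2.1.1, t.1.2.2.1] i := fun i => ofCoord_coord h _
    rcases j with ⟨i, p⟩ | ⟨i, x⟩ | ⟨j, x, y⟩
    · exact sub_eq_zero.2 (congrFun (congrArg (coord c g) (e i)) p)
    · refine sub_eq_zero.2 ?_
      change normS (R := R) S (ofCoord c g (coord c g (![t.1.1.1, t.1.2.1.1, t.1.2.2.1] i)) _) = _
      rw [e]
      fin_cases i
      exacts [t.2.1.1 _, t.2.1.2.1 _, t.2.1.2.2 _]
    · refine sub_eq_zero.2 ?_
      change dualExt S (g j) (ofCoord c g (coord c g t.1.1.1) _) =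
        dualExt S (g j) (conjS (R := R) S (ofCoord c g (coord c g t.1.2.1.1) _) *
          conjS (R := R) S (ofCoord c g (coord c g t.1.2.2.1) _))
      rw [e0, e1, e2]
      have := t.2.2 (1 ⊗ₜ x) (1 ⊗ₜ y)
      rw [Algebra.TensorProduct.tmul_mul_tmul, mul_one] at this
      exact congrArg _ this

end Equations

variable (R C) in
theorem rtFunctor_isAffineGroupScheme : IsAffineGroupScheme (rtFunctor R C) := by
  obtain ⟨n, c, g, h⟩ := Module.exists_finite_dual_basis R C
  refine isCorepresentable_of_zeroLocus (rtFunctor R C ⋙ forget GrpCat.{u})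
    (fun S (t : RT' R C S) (i : Fin 3 × Fin n × Fin n) =>
      ScalarChange.coord c g (![t.1.1.1, t.1.2.1.1, t.1.2.2.1] i.1) i.2)
    ?_ ?_ (rtEquation c g) (rtEquation_natural c g) (rtEquation_eq_zero_iff h)
  · rintro S T f (t : RT' R C S) ⟨i, p⟩
    rw [← ScalarChange.coord_endMap]
    fin_cases i <;> rfl
  · rintro S (t : RT' R C S) (t' : RT' R C S) htt
    have key : ∀ i : Fin 3, ![t.1.1.1, t.1.2.1.1, t.1.2.2.1] i =
        ![t'.1.1.1, t'.1.2.1.1, t'.1.2.2.1] i := fun i => by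
      rw [← ScalarChange.ofCoord_coord h (![t.1.1.1, t.1.2.1.1, t.1.2.2.1] i),
        ← ScalarChange.ofCoord_coord h (![t'.1.1.1, t'.1.2.1.1, t'.1.2.2.1] i)]
      exact congrArg _ (funext fun p => congrFun htt (i, p))
    exact Subtype.ext (Prod.ext (Units.ext (key 0)) (Prod.ext (Units.ext (key 1))
      (Units.ext (key 2))))

variable (R C) in
/-- The isomorphism `RT'(C) ≅ Spin(q_C)`. -/
noncomputable def rtIsoSpin : rtFunctor R C ≅ spinFunctor R C :=
  NatIso.ofComponents
    (fun S => (MulEquiv.ofBijective (rtToSpin R C S) (rtToSpin_bijective R C S)).toGrpIso)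
    (fun {S T} f => by
      refine GrpCat.hom_ext (MonoidHom.ext fun t => ?_)
      exact rtToSpin_rtMap f.hom t)

end OctonionAlgebra

open OctonionAlgebra in
theorem mainTheorem7 {R : Type u} [CommRing R] {C : Type u} [NonAssocRing C] [Module R C]
    [SMulCommClass R C C] [IsScalarTower R C C] [OctonionAlgebra R C] :
    IsAffineGroupScheme (spinFunctor R C) ∧
    IsAffineGroupScheme (rtFunctor R C) ∧
    (∀ S : CommAlgCat.{u} R, Function.Bijective (alphaEvenS (R := R) (C := C) S)) ∧
    (∃ F : spinFunctor R C ⟶ rtFunctor R C, IsIso F ∧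
      ∀ (S : CommAlgCat.{u} R) (u : Spin R C S) (t : RT' R C S), F.app S u = t →
        (∀ x : S ⊗[R] C, iotaS S (t.1.1.1 x) =
          evenS S u.1.1 * iotaS S x * evenS S u.1⁻¹.1) ∧
        (t.1.2.2.1, t.1.2.1.1) = alphaEvenS S u.1.1) ∧
    ∀ S : CommAlgCat.{u} R, RT' R C S = RT R C S := by
  have hrt := rtFunctor_isAffineGroupScheme R C
  refine ⟨?_, hrt, fun S => alphaEvenS_bijective R C S,
    ⟨(rtIsoSpin R C).inv, inferInstance, fun S u t h => ?_⟩, fun S => RT'_eq_RT⟩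
  -- Spin is represented by the ring of RT', through the isomorphism; it needs no equations of its
  -- own.
  · have : (rtFunctor R C ⋙ forget GrpCat.{u}).IsCorepresentable := hrt
    exact corepresentable_of_natIso _ (Functor.isoWhiskerRight (rtIsoSpin R C) (forget GrpCat.{u}))
  -- F is the inverse of t ↦ α''⁻¹(t₃, t₂), so the formulas for F(u) = t are those of the inverse
  -- map at t.
  · have hu : rtToSpin R C S t = u := by
      rw [← h]
      exact (MulEquiv.ofBijective (rtToSpin R C S) (rtToSpin_bijective R C S)).apply_symm_apply u
    rw [← hu]
    exact ⟨rtToSpin_conj t, (alphaEvenS_rtToSpin t).symm⟩
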